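/- **Setting.** Let $\Omega\subset\mathbb R^n$ be a bounded open set containing $0$, $r>0$, $f:\Omega\to\mathbb R^n$, $g:\Omega\to\mathbb R^{n\times m}$, $q:\Omega\to\mathbb R$ Lipschitz, $g$ of class $C^\infty$, with $f(x)=Ax+O(|x|^2)$ and $q(x)=\frac12x^TQx+O(|x|^3)$ as $x\to0$, $Q$ symmetric. Put $R(x)=r^{-1}g(x)g(x)^T$. Assume that $\begin{pmatrix}A&-R(0)\\-Q&-A^T\end{pmatrix}$ has no eigenvalue on the imaginary axis and that its stable generalized eigenspace $E_-$ satisfies $E_-\oplus\operatorname{Im}(0,I_n)^T=\mathbb R^{2n}$. Let $V$ be differentiable on $\Omega$, $p=\nabla V$, with $$p^Tf-\tfrac12p^TRp+q=0\ \text{ in }\Omega,\qquad p(0)=0,$$ such that $0$ is an asymptotically stable equilibrium of $f-Rp$ and $V$ has a Hessian $P=\frac{\partial^2V}{\partial x^2}(0)$ at $0$ (that is, $p$ is differentiable at $0$ with derivative $P$). Let $L>0$ be a common Lipschitz constant of $f,g,R,p$ on $\Omega$. Fix $\kappa\in\mathbb R$ and let $$J(x,u)=\int_0^\infty\Big(\kappa\,q(x(t))+\tfrac12\,r\,|u(t)|^2\Big)dt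 .$$ ($\kappa=\frac12$ gives the running cost $\frac12(q+ru^Tu)$; $\kappa=1$ gives the cost whose dynamic programming equation is the equation for $V$ above.) A network $p^{NN}(\theta,\cdot):\mathbb R^n\to\mathbb R^n$ with $d$ layers of width $M$ is a map $x\mapsto WS^{d+1}+b$, where $S^1=\sigma(W^1x+b^1)$ and, for $i=1,\dots,d$, $S^{i+1}=(1-G^i)\odot H^i+Z^i\odot S^i$ with $Z^i=\sigma(U^{z,i}x+W^{z,i}S^i+b^{z,i})$, $G^i=\sigma(U^{g,i}x+W^{g,i}S^i+b^{g,i})$, $R^i=\sigma(U^{r,i}x+W^{r,i}S^i+b^{r,i})$, $H^i=\sigma(U^{h,i}x+W^{h,i}(S^i\odot R^i)+b^{h,i})$; here $\sigma=\sin$ coordinatewise, $\odot$ is the entrywise product, and $\theta$ is the collection of all the real matrices $W^1,U^{\cdot,i},W^{\cdot,i},W$ and vectors $b^1,b^{\cdot,i},b$, of matching sizes. **Statement.** There are constants $\beta>0$ and $M_0$ with $\|e^{(A-R(0)P)t}\|\le M_0e^{-\beta t}$ for $t\ge0$, and constants $\alpha>0$, $C_0\ge1$, $C>0$, all depending only on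 $\Omega,f,g,q,r,V,L,\kappa$, such that the following holds. For all $\gamma_0>0$, $k\in\mathbb R$ and compact $K\subset\Omega$ there is $\varepsilon_1\in(0,\gamma_0]$ such that for every $\varepsilon_0\in(0,\varepsilon_1)$, every network $p^{NN}(\theta,\cdot)$ of any depth and width with $$|p^{NN}(\theta,x)-Px|\le k|x|^2\quad\text{for all }x\in\Omega,\ |x|<\gamma_0,$$ and every solution $x$ on $[0,\infty)$ of $\dot x=f(x)-R(x)p(x)$, $x(0)=x_0$, with values in $K$: if $$0<\varepsilon<\frac{\varepsilon_0}{2C_0},\qquad T_\varepsilon>0\ \text{ satisfies }\ |x(t)|<\varepsilon/2\ \ \forall t\ge T_\varepsilon,\qquad \delta<C_0^{-1}\beta e^{-C_0LT_\varepsilon}\varepsilon/2,$$ and $|p^{NN}(\theta,y)-p(y)|<\delta$ for all $y\in\Omega$, then $\dot x=f(x)-R(x)p^{NN}(\theta,x)$, $x(0)=x_0$, has a solution in $\Omega$ on $[0,\infty)$, and every such solution $x^{NN}$ satisfies $$|x^{NN}(t)-x(t)|\le C_0\delta e^{C_0Lt}\ \ (0\le t\le T_\varepsilon),\qquad |x^{NN}(t)|\le\varepsilon_0e^{-\alpha(t-T_\varepsilon)}\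 \ (t>T_\varepsilon),$$ and, with the feedback controls $u=-r^{-1}g(x)^Tp(x)$ along $x$ and $u^{NN}=-r^{-1}g(x^{NN})^Tp^{NN}(\theta,x^{NN})$ along $x^{NN}$, the integrals defining $J(x,u)$ and $J(x^{NN},u^{NN})$ converge absolutely and $$|J(x^{NN},u^{NN})-J(x,u)|\le C\varepsilon_0 .$$ -/

import Mathlib

open Set Filter Topology Asymptotics
open scoped NNReal ContDiff InnerProductSpace Matrix

/-! Matrices carry the operator norm induced by the Euclidean norms. -/
open scoped Matrix.Norms.L2Operator

noncomputable section

namespace NNFeedback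

/-- The state space `ℝⁿ` with the Euclidean norm. -/
abbrev E (n : ℕ) : Type := EuclideanSpace ℝ (Fin n)

/-- The data of the optimal control problem `ẋ = f(x) + g(x) u` in `Ω ⊆ ℝⁿ`, with controls
`u ∈ ℝᵐ`, state cost `q` and control weight `r`. -/
structure ControlProblem (n m : ℕ) where
  Ω : Set (E n)
  f : E n → E n
  g : E n → Matrix (Fin n) (Fin m) ℝ
  q : E n → ℝ
  r : ℝ

/-- `x` solves `ẋ = F(x)` on the time set `s`, with values in `Ω`
(one-sided derivatives at the end points of `s`). -/
def IsSolutionOn {n : ℕ} (F : E n → E n) (Ω : Set (E n)) (s : Set ℝ) (x : ℝ → E n) : Prop :=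
  ∀ t ∈ s, x t ∈ Ω ∧ HasDerivWithinAt x (F (x t)) s t

/-- `0` is an asymptotically stable equilibrium of the vector field `F` on `Ω`: an equilibrium,
Lyapunov stable (tested on all solutions, also those living on a bounded time interval only),
and attractive. -/
structure IsAsymptoticallyStable {n : ℕ} (F : E n → E n) (Ω : Set (E n)) : Prop where
  equilibrium : F 0 = 0
  stable : ∀ η > 0, ∃ ρ > 0, ∀ (T : ℝ) (y : ℝ → E n), IsSolutionOn F Ω (Icc 0 T) y →
    ‖y 0‖ < ρ → ∀ t ∈ Icc 0 T, ‖y t‖ < η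
  attractive : ∃ ρ > 0, ∀ y : ℝ → E n, IsSolutionOn F Ω (Ici 0) y →
    ‖y 0‖ < ρ → Tendsto y atTop (𝓝 0)

/-- A real square matrix is hyperbolic if no complex eigenvalue lies on the imaginary axis. -/
def IsHyperbolic {ι : Type} [Fintype ι] [DecidableEq ι] (H : Matrix ι ι ℝ) : Prop :=
  ∀ μ : ℂ, Module.End.HasEigenvalue (Matrix.toLin' (H.map (algebraMap ℝ ℂ))) μ → μ.re ≠ 0

/-- The real vectors in the sum of the complex generalized eigenspaces of `H`
for the eigenvalues with negative real part. -/
def stableSubspace {ι : Type} [Fintype ι] [DecidableEq ι] (H : Matrix ι ι ℝ) :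
    Submodule ℝ (ι → ℝ) :=
  ((⨆ μ ∈ {μ : ℂ | μ.re < 0},
      Module.End.maxGenEigenspace (Matrix.toLin' (H.map (algebraMap ℝ ℂ))) μ).restrictScalars
    ℝ).comap ((Algebra.linearMap ℝ ℂ).compLeft ι)

namespace ControlProblem

variable {n m : ℕ} (S : ControlProblem n m)

/-- `R(x) = r⁻¹ g(x) g(x)ᵀ`. -/
def R (x : E n) : Matrix (Fin n) (Fin n) ℝ := S.r⁻¹ • (S.g x * (S.g x)ᵀ)

/-- Regularity and expansions at the origin:
`f(x) = A x + O(|x|²)`, `q(x) = ½ xᵀ Q x + O(|x|³)`, `Q` symmetric, `f, g, q` Lipschitz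
and `g` smooth on `Ω`. -/
structure C1 (A Q : Matrix (Fin n) (Fin n) ℝ) : Prop where
  f_lipschitz : ∃ c : ℝ≥0, LipschitzOnWith c S.f S.Ω
  g_lipschitz : ∃ c : ℝ≥0, LipschitzOnWith c S.g S.Ω
  q_lipschitz : ∃ c : ℝ≥0, LipschitzOnWith c S.q S.Ω
  f_expansion : (fun x => S.f x - Matrix.toEuclideanLin A x) =O[𝓝 0] fun x => ‖x‖ ^ 2
  q_expansion : (fun x => S.q x - 1 / 2 * ⟪x, Matrix.toEuclideanLin Q x⟫_ℝ)
    =O[𝓝 0] fun x => ‖x‖ ^ 3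
  Q_symm : Q.IsSymm
  g_smooth : ContDiffOn ℝ ∞ S.g S.Ω

/-- The Hamiltonian matrix `[[A, -R(0)], [-Q, -Aᵀ]]`. -/
def Ham (A Q : Matrix (Fin n) (Fin n) ℝ) : Matrix (Fin n ⊕ Fin n) (Fin n ⊕ Fin n) ℝ :=
  Matrix.fromBlocks A (-S.R 0) (-Q) (-Aᵀ)

/-- The Hamiltonian matrix is hyperbolic, and its stable generalized eigenspace is complementary
to the image of `(0, Iₙ)ᵀ`. -/
structure C2 (A Q : Matrix (Fin n) (Fin n) ℝ) : Prop where
  hyperbolic : IsHyperbolic (S.Ham A Q)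
  complementary : IsCompl (stableSubspace (S.Ham A Q))
    (LinearMap.range (Matrix.toLin'
      (Matrix.fromRows (0 : Matrix (Fin n) (Fin n) ℝ) (1 : Matrix (Fin n) (Fin n) ℝ))))

/-- The vector field `f(x) - R(x) p(x)` of the closed loop driven by the costate map `p`. -/
def closedLoop (p : E n → E n) (x : E n) : E n :=
  S.f x - Matrix.toEuclideanLin (S.R x) (p x)

/-- The feedback `u(x) = -r⁻¹ g(x)ᵀ p(x)`. -/
def feedback (p : E n → E n) (x : E n) : E m :=
  -(S.r⁻¹ • Matrix.toEuclideanLin (S.g x)ᵀ (p x))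

/-- `V` is a stabilizing solution on `Ω` of the Hamilton-Jacobi equation
`∇Vᵀ f - ½ ∇Vᵀ R ∇V + q = 0`. -/
structure IsStabilizingSolution (V : E n → ℝ) : Prop where
  differentiable : ∀ x ∈ S.Ω, DifferentiableAt ℝ V x
  hamiltonJacobi : ∀ x ∈ S.Ω,
    ⟪gradient V x, S.f x⟫_ℝ
      - 1 / 2 * ⟪gradient V x, Matrix.toEuclideanLin (S.R x) (gradient V x)⟫_ℝ + S.q x = 0
  gradient_zero : gradient V 0 = 0
  stable : IsAsymptoticallyStable (S.closedLoop (gradient V)) S.Ω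

/-- The running cost `κ q(x) + ½ r uᵀu`. The value `κ = 1/2` gives `½ (q(x) + r uᵀu)`; the value
`κ = 1` gives the cost whose dynamic programming equation is the Hamilton-Jacobi equation in
`IsStabilizingSolution`. -/
def runningCost (κ : ℝ) (x : E n) (u : E m) : ℝ :=
  κ * S.q x + 1 / 2 * (S.r * ‖u‖ ^ 2)

/-- The infinite-horizon cost `J(x, u) = ∫₀^∞ (κ q(x(t)) + ½ r |u(t)|²) dt`. -/
def J (κ : ℝ) (x : ℝ → E n) (u : ℝ → E m) : ℝ :=
  ∫ t in Ioi (0 : ℝ), S.runningCost κ (x t) (u t)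

/-- The integral that defines `J(x, u)` converges absolutely. -/
def FiniteCost (κ : ℝ) (x : ℝ → E n) (u : ℝ → E m) : Prop :=
  MeasureTheory.IntegrableOn (fun t => S.runningCost κ (x t) (u t)) (Ioi (0 : ℝ))

end ControlProblem

/-- `T` is an admissible time of the trajectory `x` with respect to `ε`. -/
def IsAdmissibleTime {n : ℕ} (x : ℝ → E n) (ε T : ℝ) : Prop :=
  0 < T ∧ ∀ t ≥ T, ‖x t‖ < ε / 2

/-- The parameters of a network with `depth + 1` hidden layers, `width` units per sub-layer,
and input and output in `ℝⁿ`. -/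
structure NetParams (n depth width : ℕ) where
  W₁ : Matrix (Fin width) (Fin n) ℝ
  b₁ : Fin width → ℝ
  Uz : Fin depth → Matrix (Fin width) (Fin n) ℝ
  Wz : Fin depth → Matrix (Fin width) (Fin width) ℝ
  bz : Fin depth → Fin width → ℝ
  Ug : Fin depth → Matrix (Fin width) (Fin n) ℝ
  Wg : Fin depth → Matrix (Fin width) (Fin width) ℝ
  bg : Fin depth → Fin width → ℝ
  Ur : Fin depth → Matrix (Fin width) (Fin n) ℝ
  Wr : Fin depth → Matrix (Fin width) (Fin width) ℝ
  br : Fin depth → Fin width → ℝ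
  Uh : Fin depth → Matrix (Fin width) (Fin n) ℝ
  Wh : Fin depth → Matrix (Fin width) (Fin width) ℝ
  bh : Fin depth → Fin width → ℝ
  W : Matrix (Fin n) (Fin width) ℝ
  b : Fin n → ℝ

namespace NetParams

variable {n depth width : ℕ} (θ : NetParams n depth width)

/-- The activation: the sine, coordinate by coordinate. -/
def act (z : Fin width → ℝ) : Fin width → ℝ := fun j => Real.sin (z j)

/-- One LSTM-like layer `S ↦ (1 - G) ⊙ H + Z ⊙ S`
(`*` on functions is the Hadamard product). -/
def layer (x : E n) (i : Fin depth) (S : Fin width → ℝ) : Fin width → ℝ :=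
  let Z := act (θ.Uz i *ᵥ x.ofLp + θ.Wz i *ᵥ S + θ.bz i)
  let G := act (θ.Ug i *ᵥ x.ofLp + θ.Wg i *ᵥ S + θ.bg i)
  let R := act (θ.Ur i *ᵥ x.ofLp + θ.Wr i *ᵥ S + θ.br i)
  let H := act (θ.Uh i *ᵥ x.ofLp + θ.Wh i *ᵥ (S * R) + θ.bh i)
  (1 - G) * H + Z * S

/-- The states `S¹, …, S^{depth+1}`, indexed from `0`. -/
def state (x : E n) (i : Fin (depth + 1)) : Fin width → ℝ :=
  Fin.induction (motive := fun _ => Fin width → ℝ)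
    (act (θ.W₁ *ᵥ x.ofLp + θ.b₁)) (fun i S => θ.layer x i S) i

/-- The network `x ↦ W S^{depth+1} + b`. -/
def eval (x : E n) : E n :=
  WithLp.toLp 2 (θ.W *ᵥ θ.state x (Fin.last depth) + θ.b)

end NetParams

end NNFeedback

end

open NNFeedback

/-! One quadratic Lyapunov function controls everything near the origin, and it is robust enough to
serve the exact closed loop and every network with a quadratic error bound.

Put M = A - R(0)P. The second-order part of the Hamilton-Jacobi equation at 0 is a Riccati equation
(`riccati_quadratic`, `riccati`; P is symmetric by `isSymm_hessian`). It says that the graph of P is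
invariant under the Hamiltonian matrix, which acts there as M, so M is hyperbolic
(`isHyperbolic_closedLoop`). Hence there is a symmetric form W with W(x, Mx) positive definite
(`IsHyperbolic.exists_form_pos`), and W increases strictly along nonzero solutions of the nonlinear
closed loop near 0. Stability then excludes vectors with W(x, x) > 0, as in Chetaev's theorem
(`form_nonpos_of_stable`), and Cauchy-Schwarz improves W ≤ 0 to negative definiteness
(`negDef_of_nonpos`). So U = -W is a Lyapunov function for M. It bounds exp(tM), and by giving up
half of the decay it also works for both nonlinear fields in a small ball.

Up to time T, Grönwall's inequality keeps the network trajectory within ε/2 of the exact one; at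
time T it lies in the ball of radius ε, where U takes over (`exists_and_forall_shadowing`).
Existence follows from the same estimates: a solution of a globally extended field cannot leave Ω.
On [0, T] the running costs differ by at most a multiple of C₀ δ exp(C₀Lt), whose integral is
governed by its value at T, hence by ε and not by the length T; both tails are O(ε₀) by exponential
decay (`finiteCost_and_abs_J_sub_le`). -/

noncomputable section

namespace NNFeedback

/-! ### Quadratic forms adapted to hyperbolic linear maps -/

/-- A quadratic Young inequality, in the form used to absorb cross terms. -/
lemma young_absorb {c D k a s : ℝ} (hc : 0 < c) (hk : D ^ 2 / (2 * c) + c / 2 ≤ k) :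
    c / 2 * (a ^ 2 + s ^ 2) ≤ c * a ^ 2 - D * (a * s) + k * s ^ 2 := by
  have h1 : 0 ≤ c / 2 * (a - D * s / c) ^ 2 := by positivity
  have h2 : c / 2 * (a - D * s / c) ^ 2
      = c / 2 * a ^ 2 - D * (a * s) + D ^ 2 / (2 * c) * s ^ 2 := by
    field_simp
    ring
  nlinarith [mul_le_mul_of_nonneg_right hk (sq_nonneg s)]

/-- A linear endomorphism of a complex normed space without purely imaginary eigenvalues admits a
symmetric real bilinear form `W` such that `x ↦ W x (T x)` is positive definite. -/
theorem exists_form_pos_of_forall_re_ne_zero (d : ℕ) : ∀ (V : Type) [NormedAddCommGroup V]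
    [NormedSpace ℂ V] [FiniteDimensional ℂ V] (T : Module.End ℂ V),
    Module.finrank ℂ V = d → (∀ μ : ℂ, T.HasEigenvalue μ → μ.re ≠ 0) →
    ∃ W : V →L[ℝ] V →L[ℝ] ℝ, (∀ x y, W x y = W y x) ∧
      ∃ c > 0, ∀ x, c * ‖x‖ ^ 2 ≤ W x (T x) := by
  induction d with
  | zero =>
    intro V _ _ _ T hd _
    have : Subsingleton V := Module.finrank_zero_iff.mp hd
    refine ⟨0, fun _ _ => rfl, 1, one_pos, fun x => ?_⟩
    simp [Subsingleton.elim x 0]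
  | succ d ih =>
    intro V _ _ _ T hd hT
    have : Nontrivial V := Module.nontrivial_of_finrank_pos (R := ℂ) (by omega)
    obtain ⟨μ, hμ⟩ := Module.End.exists_eigenvalue T
    have hμre := hT μ hμ
    -- Triangularize from the quotient side: T - μ is not surjective, so some nonzero functional φ
    -- vanishes on its range. It satisfies φ ∘ T = μ φ, and its kernel is an invariant hyperplane to
    -- which the induction hypothesis applies.
    have hrange : LinearMap.range (T - algebraMap ℂ (Module.End ℂ V) μ) < ⊤ := by
      rw [lt_top_iff_ne_top, Ne, LinearMap.range_eq_top, ← LinearMap.injective_iff_surjective]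
      intro hinj
      obtain ⟨v, hv⟩ := hμ.exists_hasEigenvector
      refine hv.2 (hinj ?_)
      simp [hv.apply_eq_smul, Module.algebraMap_end_apply]
    obtain ⟨φ, hφ0, hφ⟩ := Submodule.exists_le_ker_of_lt_top _ hrange
    have hφT : ∀ x, φ (T x) = μ * φ x := by
      intro x
      have : (T - algebraMap ℂ (Module.End ℂ V) μ) x ∈ LinearMap.ker φ := hφ ⟨x, rfl⟩
      simpa [Module.algebraMap_end_apply, sub_eq_zero] using this
    obtain ⟨e', he'⟩ : ∃ e', φ e' ≠ 0 := by
      by_contra! h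
      exact hφ0 (LinearMap.ext h)
    obtain ⟨e, he⟩ : ∃ e, φ e = 1 := ⟨(φ e')⁻¹ • e', by simp [he']⟩
    set U := LinearMap.ker φ with hU
    have hTU : ∀ x ∈ U, T x ∈ U := by
      intro x hx
      rw [LinearMap.mem_ker] at hx ⊢
      rw [hφT, hx, mul_zero]
    have hfin : Module.finrank ℂ U = d := by
      have h1 := LinearMap.finrank_range_add_finrank_ker φ
      have h2 : LinearMap.range φ = ⊤ := LinearMap.range_eq_top.2 fun z => ⟨z • e, by simp [he]⟩
      rw [h2, finrank_top, Module.finrank_self, hd, ← hU] at h1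
      omega
    obtain ⟨W, hWs, c, hc, hW⟩ := ih U (T.restrict hTU) hfin (by
      intro ν hν
      obtain ⟨v, hv⟩ := hν.exists_hasEigenvector
      refine hT ν (Module.End.hasEigenvalue_of_hasEigenvector (x := (v : V)) ⟨?_, ?_⟩)
      · rw [Module.End.mem_eigenspace_iff]
        exact congrArg Subtype.val hv.apply_eq_smul
      · simpa using hv.2)
    let π' : V →ₗ[ℂ] U := LinearMap.codRestrict U (LinearMap.id - φ.smulRight e) (by
      intro x
      simp [hU, he])
    let π : V →L[ℝ] U := (LinearMap.toContinuousLinearMap π').restrictScalars ℝ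
    let ψ : V →L[ℝ] ℂ := (LinearMap.toContinuousLinearMap φ).restrictScalars ℝ
    have hπ : ∀ x, ((π x : U) : V) = x - φ x • e := fun x => rfl
    have hψ : ∀ x, ψ x = φ x := fun x => rfl
    have hu0 : T e - μ • e ∈ U := by simp [hU, hφT, he]
    let u0 : U := ⟨T e - μ • e, hu0⟩
    have hπT : ∀ x, π (T x) = T.restrict hTU (π x) + φ x • u0 := by
      intro x
      apply Subtype.ext
      simp only [hπ, Submodule.coe_add, LinearMap.coe_restrict_apply, Submodule.coe_smul, u0, hφT,
        map_sub, map_smul, smul_sub, mul_smul]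
      rw [smul_comm μ]
      abel
    -- In V = U ⊕ ℂe, T is triangular with off-diagonal part `u0`, which produces a cross term of
    -- size at most D ‖πx‖ ‖φ x‖; k is the weight at which Young's inequality absorbs it. Dividing
    -- the weight by Re μ makes the φ-part contribute k |φ x|² whatever the sign of Re μ.
    set D := ‖W‖ * ‖u0‖ with hD
    set k := D ^ 2 / (2 * c) + c / 2 with hk
    let W' : V →L[ℝ] V →L[ℝ] ℝ := W.bilinearComp π π
      + (k / μ.re) • ((ContinuousLinearMap.mul ℝ ℝ).bilinearComp (Complex.reCLM ∘L ψ)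
          (Complex.reCLM ∘L ψ)
        + (ContinuousLinearMap.mul ℝ ℝ).bilinearComp (Complex.imCLM ∘L ψ) (Complex.imCLM ∘L ψ))
    have hW' : ∀ x y, W' x y = W (π x) (π y) + (k / μ.re) *
        ((φ x).re * (φ y).re + (φ x).im * (φ y).im) := fun x y => rfl
    refine ⟨W', fun x y => ?_, c / 2 / (2 * (1 + ‖e‖ ^ 2)), by positivity, fun x => ?_⟩
    · rw [hW', hW', hWs]
      ring
    · have h1 : W' x (T x) = W (π x) (T.restrict hTU (π x)) + W (π x) (φ x • u0)
          + k * ‖φ x‖ ^ 2 := by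
        rw [hW', hπT, map_add, hφT]
        have : (φ x).re * (μ * φ x).re + (φ x).im * (μ * φ x).im = μ.re * ‖φ x‖ ^ 2 := by
          rw [← Complex.normSq_eq_norm_sq, Complex.normSq_apply, Complex.mul_re, Complex.mul_im]
          ring
        rw [this]
        field_simp
      have h2 : -(D * (‖π x‖ * ‖φ x‖)) ≤ W (π x) (φ x • u0) := by
        have := W.le_opNorm₂ (π x) (φ x • u0)
        rw [norm_smul, Real.norm_eq_abs] at this
        have h3 := neg_abs_le (W (π x) (φ x • u0))
        rw [hD]
        linarith
      have h3 := young_absorb (a := ‖π x‖) (s := ‖φ x‖) hc hk.symm.le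
      have h4 := hW (π x)
      have h5 : ‖x‖ ≤ ‖π x‖ + ‖φ x‖ * ‖e‖ := by
        have : x = (π x : V) + φ x • e := by rw [hπ]; abel
        calc ‖x‖ = ‖(π x : V) + φ x • e‖ := by rw [← this]
          _ ≤ _ := (norm_add_le _ _).trans_eq (by rw [norm_smul]; rfl)
      have h6 : ‖x‖ ^ 2 ≤ 2 * (1 + ‖e‖ ^ 2) * (‖π x‖ ^ 2 + ‖φ x‖ ^ 2) := by
        have h7 : ‖x‖ ^ 2 ≤ (‖π x‖ + ‖φ x‖ * ‖e‖) ^ 2 := by gcongr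
        nlinarith [sq_nonneg (‖π x‖ - ‖φ x‖ * ‖e‖), sq_nonneg (‖π x‖ * ‖e‖), sq_nonneg ‖φ x‖,
          sq_nonneg (‖φ x‖ * ‖e‖), sq_nonneg ‖π x‖]
      have h8 : c / 2 / (2 * (1 + ‖e‖ ^ 2)) * ‖x‖ ^ 2 ≤ c / 2 * (‖π x‖ ^ 2 + ‖φ x‖ ^ 2) := by
        rw [div_mul_eq_mul_div, div_le_iff₀ (by positivity)]
        nlinarith
      linarith

/-- The real form of `exists_form_pos_of_forall_re_ne_zero` for a hyperbolic matrix. -/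
theorem IsHyperbolic.exists_form_pos {n : ℕ} {A : Matrix (Fin n) (Fin n) ℝ} (hA : IsHyperbolic A) :
    ∃ W : E n →L[ℝ] E n →L[ℝ] ℝ, (∀ x y, W x y = W y x) ∧
      ∃ c > 0, ∀ x, c * ‖x‖ ^ 2 ≤ W x (Matrix.toEuclideanLin A x) := by
  obtain ⟨W, hWs, c, hc, hW⟩ := exists_form_pos_of_forall_re_ne_zero _ (Fin n → ℂ)
    (Matrix.toLin' (A.map (algebraMap ℝ ℂ))) rfl hA
  let ι' : E n →ₗ[ℝ] (Fin n → ℂ) :=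
    ((Algebra.linearMap ℝ ℂ).compLeft (Fin n)) ∘ₗ (WithLp.linearEquiv 2 ℝ (Fin n → ℝ)).toLinearMap
  let ι : E n →L[ℝ] (Fin n → ℂ) := LinearMap.toContinuousLinearMap ι'
  have hι : ∀ x j, ι x j = (x j : ℂ) := fun x j => rfl
  have hιA : ∀ x, ι (Matrix.toEuclideanLin A x)
      = Matrix.toLin' (A.map (algebraMap ℝ ℂ)) (ι x) := by
    intro x
    ext j
    rw [hι]
    simp [Matrix.toEuclideanLin, Matrix.mulVec, dotProduct, hι]
  have hnorm : ∀ x : E n, ‖x‖ ^ 2 ≤ n * ‖ι x‖ ^ 2 := by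
    intro x
    rw [EuclideanSpace.norm_sq_eq]
    calc ∑ i, ‖x i‖ ^ 2 ≤ ∑ _i : Fin n, ‖ι x‖ ^ 2 := by
          refine Finset.sum_le_sum fun i _ => ?_
          have := norm_le_pi_norm (ι x) i
          rw [hι, Complex.norm_real] at this
          gcongr
      _ = _ := by simp
  -- The factor n compares the Euclidean norm with the sup norm of `Fin n → ℂ`; n + 1 keeps the
  -- constant meaningful for n = 0.
  refine ⟨W.bilinearComp ι ι, fun x y => hWs _ _, c / (n + 1), by positivity, fun x => ?_⟩
  have h1 := hW (ι x)
  rw [← hιA] at h1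
  refine le_trans ?_ h1
  rw [div_mul_eq_mul_div, div_le_iff₀ (by positivity)]
  nlinarith [hnorm x, sq_nonneg ‖ι x‖]

/-- If `W` is symmetric and nonpositive with `x ↦ W x (T x)` positive definite, then `W` is negative
definite. -/
theorem negDef_of_nonpos {F : Type*} [NormedAddCommGroup F] [NormedSpace ℝ F]
    (W : F →L[ℝ] F →L[ℝ] ℝ) (hWs : ∀ x y, W x y = W y x)
    (T : F →L[ℝ] F) {c : ℝ} (hc : 0 < c) (hW : ∀ x, c * ‖x‖ ^ 2 ≤ W x (T x))
    (hneg : ∀ x, W x x ≤ 0) : ∃ a > 0, ∀ x, a * ‖x‖ ^ 2 ≤ -W x x := by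
  -- Cauchy-Schwarz for the semidefinite form `-W`
  have cs : ∀ x y, (W x y) ^ 2 ≤ (-W x x) * (-W y y) := by
    intro x y
    have h : ∀ t : ℝ, 0 ≤ (-W y y) * (t * t) + (-2 * W x y) * t + (-W x x) := by
      intro t
      have := hneg (x + t • y)
      simp only [map_add, map_smul, add_apply, smul_apply,
        smul_eq_mul, hWs y x] at this
      linarith
    have := discrim_le_zero h
    rw [discrim] at this
    nlinarith
  -- Cauchy-Schwarz for x and Tx gives c² ‖x‖⁴ ≤ (-W x x) (-W (Tx) (Tx)), and the last factor is at
  -- most (‖W‖ ‖T‖² + 1) ‖x‖².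
  refine ⟨c ^ 2 / (‖W‖ * ‖T‖ ^ 2 + 1), by positivity, fun x => ?_⟩
  have h1 : (c * ‖x‖ ^ 2) ^ 2 ≤ (-W x x) * (-W (T x) (T x)) :=
    (pow_le_pow_left₀ (by positivity) (hW x) 2).trans (cs x (T x))
  have h2 : -W (T x) (T x) ≤ (‖W‖ * ‖T‖ ^ 2 + 1) * ‖x‖ ^ 2 := by
    have h3 := W.le_opNorm₂ (T x) (T x)
    have h4 := T.le_opNorm x
    have h5 := neg_le_abs (W (T x) (T x))
    rw [Real.norm_eq_abs] at h3
    have h6 : ‖W‖ * ‖T x‖ * ‖T x‖ ≤ ‖W‖ * (‖T‖ * ‖x‖) * (‖T‖ * ‖x‖) := by gcongr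
    nlinarith [sq_nonneg ‖x‖]
  rcases eq_or_ne x 0 with rfl | hx
  · simp
  have hx' : 0 < ‖x‖ ^ 2 := by positivity
  rw [div_mul_eq_mul_div, div_le_iff₀ (by positivity)]
  have h7 := mul_le_mul_of_nonneg_left h2 (neg_nonneg.2 (hneg x))
  have h8 : c ^ 2 * ‖x‖ ^ 2 * ‖x‖ ^ 2 ≤ (-W x x) * (‖W‖ * ‖T‖ ^ 2 + 1) * ‖x‖ ^ 2 := by nlinarith
  exact le_of_mul_le_mul_right h8 hx'

/-! ### Ordinary differential equations -/

/-- A bounded Lipschitz vector field on a set extends to a bounded Lipschitz vector field. -/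
theorem exists_bounded_lipschitz_extension {n : ℕ} {F : E n → E n} {Ω : Set (E n)} {K : ℝ≥0}
    (hF : LipschitzOnWith K F Ω) {B : ℝ} (hB : ∀ x ∈ Ω, ‖F x‖ ≤ B) :
    ∃ (G : E n → E n) (K' B' : ℝ≥0), LipschitzWith K' G ∧ (∀ x, ‖G x‖ ≤ B') ∧ EqOn G F Ω := by
  have h1 : LipschitzOnWith (1 * K) (fun x => (F x).ofLp) Ω :=
    (PiLp.lipschitzWith_ofLp 2 (fun _ : Fin n => ℝ)).comp_lipschitzOnWith hF
  obtain ⟨g, hg, hgF⟩ := h1.extend_pi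
  let b : ℝ := max B 0
  -- Truncating each coordinate at ±b is 1-Lipschitz and does not change the values of F on Ω, whose
  -- coordinates are already bounded by b.
  let clip : (Fin n → ℝ) → (Fin n → ℝ) := fun z j => max (-b) (min b (z j))
  have hclip : LipschitzWith 1 clip := by
    refine LipschitzWith.of_dist_le_mul fun z w => ?_
    refine (dist_pi_le_iff (by positivity)).2 fun j => ?_
    have h2 : LipschitzWith 1 (fun s : ℝ => max (-b) (min b s)) :=
      (LipschitzWith.id.const_min b).const_max (-b)
    refine (h2.dist_le_mul (z j) (w j)).trans ?_
    gcongr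
    exact dist_le_pi_dist _ _ j
  have hcb : ∀ z, ‖clip z‖ ≤ b := by
    intro z
    refine (pi_norm_le_iff_of_nonneg (le_max_right _ _)).2 fun j => ?_
    rw [Real.norm_eq_abs, abs_le]
    exact ⟨le_max_left _ _, max_le (by linarith [le_max_right B 0]) (min_le_left _ _)⟩
  obtain ⟨k, hlip⟩ : ∃ k, LipschitzWith k (WithLp.toLp 2 : (Fin n → ℝ) → E n) :=
    ⟨_, PiLp.lipschitzWith_toLp 2 (fun _ : Fin n => ℝ)⟩
  refine ⟨fun x => WithLp.toLp 2 (clip (g x)), _, k * b.toNNReal, hlip.comp (hclip.comp hg),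
    fun x => ?_, fun x hx => ?_⟩
  · have h3 := hlip.dist_le_mul (clip (g x)) 0
    rw [WithLp.toLp_zero, dist_zero_right, dist_zero_right] at h3
    refine h3.trans ?_
    rw [NNReal.coe_mul, Real.coe_toNNReal b (le_max_right _ _)]
    gcongr
    exact hcb _
  · have h4 : clip (g x) = (F x).ofLp := by
      rw [← hgF hx]
      ext j
      have h5 : |F x j| ≤ b := by
        have := (PiLp.norm_apply_le (F x) j).trans (hB x hx)
        exact this.trans (le_max_left _ _)
      rw [abs_le] at h5
      change max (-b) (min b (F x j)) = F x j
      rw [min_eq_right h5.2, max_eq_right h5.1]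
    simp only [h4]

lemma hasDerivWithinAt_Ici_of_Icc {n : ℕ} {y : ℝ → E n} {y' : E n} {a b t : ℝ}
    (ht : t ∈ Ico a b) (h : HasDerivWithinAt y y' (Icc a b) t) :
    HasDerivWithinAt y y' (Ici t) t :=
  h.mono_of_mem_nhdsWithin (mem_of_superset (Icc_mem_nhdsGE ht.2) (Icc_subset_Icc_left ht.1))

/-- A bounded Lipschitz vector field has forward global solutions. -/
theorem exists_solution_Ici {n : ℕ} {G : E n → E n} {K B : ℝ≥0} (hG : LipschitzWith K G)
    (hB : ∀ x, ‖G x‖ ≤ B) (x₀ : E n) :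
    ∃ y : ℝ → E n, y 0 = x₀ ∧ ∀ t ∈ Ici (0 : ℝ), HasDerivWithinAt y (G (y t)) (Ici 0) t := by
  have hex : ∀ N : ℕ, ∃ y : ℝ → E n, y 0 = x₀ ∧
      ∀ t ∈ Icc (0 : ℝ) N, HasDerivWithinAt y (G (y t)) (Icc 0 N) t := by
    intro N
    have h0 : (0 : ℝ) ∈ Icc (0 : ℝ) N := ⟨le_rfl, Nat.cast_nonneg N⟩
    -- A field bounded by B moves a point by at most B N in time N, so the ball of radius B N allows
    -- the whole interval [0, N].
    have hPL : IsPicardLindelof (fun _ => G) (⟨0, h0⟩ : Icc (0 : ℝ) N) x₀ (B * N) 0 B K :=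
      { lipschitzOnWith := fun _ _ => hG.lipschitzOnWith
        continuousOn := fun _ _ => continuousOn_const
        norm_le := fun _ _ x _ => hB x
        mul_max_le := by simp }
    exact hPL.exists_eq_forall_mem_Icc_hasDerivWithinAt₀
  choose y hy0 hy using hex
  have hcons : ∀ N M : ℕ, N ≤ M → EqOn (y N) (y M) (Icc (0 : ℝ) N) := by
    intro N M hNM
    have hsub : Icc (0 : ℝ) N ⊆ Icc 0 M := Icc_subset_Icc_right (by exact_mod_cast hNM)
    have hM : ∀ t ∈ Icc (0 : ℝ) N, HasDerivWithinAt (y M) (G (y M t)) (Icc 0 N) t :=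
      fun t ht => (hy M t (hsub ht)).mono hsub
    exact ODE_solution_unique_of_mem_Icc_right (v := fun _ => G) (s := fun _ => univ)
      (fun _ _ => hG.lipschitzOnWith)
      (fun t ht => (hy N t ht).continuousWithinAt)
      (fun t ht => hasDerivWithinAt_Ici_of_Icc ht (hy N t (Ico_subset_Icc_self ht)))
      (fun _ _ => mem_univ _)
      (fun t ht => (hM t ht).continuousWithinAt)
      (fun t ht => hasDerivWithinAt_Ici_of_Icc ht (hM t (Ico_subset_Icc_self ht)))
      (fun _ _ => mem_univ _) ((hy0 N).trans (hy0 M).symm)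
  let Y : ℝ → E n := fun t => y (⌊t⌋₊ + 1) t
  have hY : ∀ (N : ℕ) (t : ℝ), 0 ≤ t → t ≤ N → Y t = y N t := by
    intro N t h0 hN
    have hlt : t ≤ (⌊t⌋₊ + 1 : ℕ) := by exact_mod_cast (Nat.lt_floor_add_one t).le
    rcases le_total N (⌊t⌋₊ + 1) with h | h
    · exact (hcons _ _ h ⟨h0, hN⟩).symm
    · exact hcons _ _ h ⟨h0, hlt⟩
  refine ⟨Y, ?_, fun t ht => ?_⟩
  · rw [hY 0 0 le_rfl (by simp), hy0]
  · obtain ⟨N, hN⟩ := exists_nat_gt t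
    have h1 := hy N t ⟨ht, hN.le⟩
    have h2 : HasDerivWithinAt Y (G (y N t)) (Icc 0 N) t :=
      h1.congr (fun s hs => hY N s hs.1 hs.2) (hY N t ht hN.le)
    rw [hY N t ht hN.le]
    refine h2.mono_of_mem_nhdsWithin ?_
    have h3 : Iic (N : ℝ) ∈ 𝓝[Ici 0] t := mem_nhdsWithin_of_mem_nhds (Iic_mem_nhds hN)
    filter_upwards [h3, self_mem_nhdsWithin] with s h4 h5 using ⟨h5, h4⟩

/-- A continuous curve that is in the closed set `N ⊆ O` as long as it has stayed in the open set
`O` never leaves `O`. -/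
theorem forall_mem_of_no_exit {X : Type*} [TopologicalSpace X] {a b : ℝ} {y : ℝ → X}
    (hy : ContinuousOn y (Icc a b)) {O N : Set X} (hO : IsOpen O) (hN : IsClosed N) (hNO : N ⊆ O)
    (ha : y a ∈ O) (h : ∀ τ ∈ Icc a b, (∀ t ∈ Icc a τ, y t ∈ O) → y τ ∈ N) :
    ∀ t ∈ Icc a b, y t ∈ O := by
  by_contra! hcon
  obtain ⟨t₀, ht₀, hbad⟩ := hcon
  have hcl : IsClosed (Icc a b ∩ y ⁻¹' Oᶜ) :=
    hy.preimage_isClosed_of_isClosed isClosed_Icc hO.isClosed_compl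
  -- τ is the first exit time. Before τ the curve lies in the closed set N, so y τ lies in N ⊆ O by
  -- continuity.
  obtain ⟨τ, ⟨hτ, hτO⟩, hmin⟩ :=
    (isCompact_Icc.of_isClosed_subset hcl inter_subset_left).exists_isLeast ⟨t₀, ht₀, hbad⟩
  have haτ : a < τ := lt_of_le_of_ne hτ.1 fun h => hτO (h ▸ ha)
  have hbefore : ∀ t ∈ Ico a τ, y t ∈ O := by
    intro t ht
    by_contra hn
    exact absurd (hmin ⟨⟨ht.1, ht.2.le.trans hτ.2⟩, hn⟩) (not_le.2 ht.2)
  have hNt : ∀ t ∈ Ico a τ, y t ∈ N := fun t ht =>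
    h t ⟨ht.1, ht.2.le.trans hτ.2⟩ fun s hs => hbefore s ⟨hs.1, hs.2.trans_lt ht.2⟩
  have hc : ContinuousWithinAt y (Ico a τ) τ :=
    (hy τ hτ).mono fun t ht => ⟨ht.1, ht.2.le.trans hτ.2⟩
  have hmem : τ ∈ closure (Ico a τ) := by
    rw [closure_Ico haτ.ne]
    exact ⟨haτ.le, le_rfl⟩
  have : y τ ∈ closure N := hc.mem_closure hmem hNt
  rw [hN.closure_eq] at this
  exact hτO (hNO this)

lemma hasDerivWithinAt_form {F : Type*} [NormedAddCommGroup F] [NormedSpace ℝ F]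
    (U : F →L[ℝ] F →L[ℝ] ℝ) (hU : ∀ x y, U x y = U y x) {y : ℝ → F} {y' : F} {s : Set ℝ} {t : ℝ}
    (h : HasDerivWithinAt y y' s t) :
    HasDerivWithinAt (fun t => U (y t) (y t)) (2 * U (y t) y') s t := by
  have h1 : HasDerivWithinAt (fun t => U (y t)) (U y') s t :=
    U.hasFDerivAt.comp_hasDerivWithinAt t h
  refine (h1.clm_apply h).congr_deriv ?_
  rw [hU y']
  ring

/-- The differential inequality `f' ≤ -λ f` implies exponential decay. -/
theorem le_mul_exp_of_deriv_le {f f' : ℝ → ℝ} {a b l : ℝ}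
    (hf : ∀ t ∈ Icc a b, HasDerivWithinAt f (f' t) (Icc a b) t)
    (hf' : ∀ t ∈ Icc a b, f' t ≤ -l * f t) :
    ∀ t ∈ Icc a b, f t ≤ f a * Real.exp (-l * (t - a)) := by
  have hd : ∀ t ∈ Icc a b, HasDerivWithinAt (fun t => f t * Real.exp (l * (t - a)))
      (f' t * Real.exp (l * (t - a)) + f t * (Real.exp (l * (t - a)) * l)) (Icc a b) t := by
    intro t ht
    have h1 : HasDerivAt (fun t : ℝ => l * (t - a)) l t := by
      simpa using ((hasDerivAt_id t).sub_const a).const_mul l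
    exact (hf t ht).mul h1.exp.hasDerivWithinAt
  have hanti := antitoneOn_of_hasDerivWithinAt_nonpos (convex_Icc a b)
    (fun t ht => (hd t ht).continuousWithinAt)
    (fun t ht => (hd t (interior_subset ht)).mono interior_subset)
    (fun t ht => by
      have h2 := hf' t (interior_subset ht)
      nlinarith [Real.exp_pos (l * (t - a))])
  intro t ht
  have h3 := hanti ⟨le_rfl, ht.1.trans ht.2⟩ ht ht.1
  simp only [sub_self, mul_zero, Real.exp_zero, mul_one] at h3
  have h4 : f t = f t * Real.exp (l * (t - a)) * Real.exp (-l * (t - a)) := by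
    rw [mul_assoc, ← Real.exp_add]
    simp
  rw [h4]
  gcongr

/-- Exponential decay along a solution that starts close to the origin, from a quadratic strict
Lyapunov function on a ball. -/
theorem norm_le_mul_exp_of_lyapunov {n : ℕ} {U : E n →L[ℝ] E n →L[ℝ] ℝ}
    (hU : ∀ x y, U x y = U y x) {a b D α ρ : ℝ} (ha : 0 < a) (hD : 0 ≤ D) (hα : 0 ≤ α)
    (hbD : b ≤ D ^ 2 * a)
    (hUa : ∀ x, a * ‖x‖ ^ 2 ≤ U x x) (hUb : ∀ x, U x x ≤ b * ‖x‖ ^ 2)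
    {F : E n → E n} {Ω : Set (E n)}
    (hF : ∀ x ∈ Ω, ‖x‖ < ρ → U x (F x) ≤ -α * U x x) {t₀ t₁ : ℝ} {y : ℝ → E n}
    (hy : IsSolutionOn F Ω (Icc t₀ t₁) y) (hy₀ : ‖y t₀‖ < ρ) (hy₁ : D * ‖y t₀‖ < ρ) :
    ∀ t ∈ Icc t₀ t₁, ‖y t‖ ≤ D * ‖y t₀‖ * Real.exp (-α * (t - t₀)) := by
  -- Bootstrap: the decay estimate holds as long as the solution stays in the ball, and it confines
  -- the solution to the smaller closed ball of radius D ‖y t₀‖, so the solution never exits.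
  have key : ∀ τ ∈ Icc t₀ t₁, (∀ t ∈ Icc t₀ τ, y t ∈ Metric.ball (0 : E n) ρ) →
      ‖y τ‖ ≤ D * ‖y t₀‖ * Real.exp (-α * (τ - t₀)) := by
    intro τ hτ hin
    have hsub : Icc t₀ τ ⊆ Icc t₀ t₁ := Icc_subset_Icc_right hτ.2
    have h1 : U (y τ) (y τ) ≤ U (y t₀) (y t₀) * Real.exp (-(2 * α) * (τ - t₀)) :=
      le_mul_exp_of_deriv_le (f := fun t => U (y t) (y t))
      (fun t ht => hasDerivWithinAt_form U hU ((hy t (hsub ht)).2.mono hsub))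
      (fun t ht => by
        have := hF (y t) (hy t (hsub ht)).1 (mem_ball_zero_iff.1 (hin t ht))
        linarith) τ ⟨hτ.1, le_rfl⟩
    have h2 : Real.exp (-(2 * α) * (τ - t₀)) = Real.exp (-α * (τ - t₀)) ^ 2 := by
      rw [← Real.exp_nat_mul]
      congr 1
      push_cast
      ring
    rw [h2] at h1
    refine le_of_sq_le_sq ?_ (by positivity)
    refine le_of_mul_le_mul_left (a := a) ?_ ha
    calc a * ‖y τ‖ ^ 2 ≤ U (y τ) (y τ) := hUa _
      _ ≤ U (y t₀) (y t₀) * Real.exp (-α * (τ - t₀)) ^ 2 := h1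
      _ ≤ D ^ 2 * a * ‖y t₀‖ ^ 2 * Real.exp (-α * (τ - t₀)) ^ 2 := by
          gcongr
          exact (hUb _).trans (by gcongr)
      _ = _ := by ring
  intro t ht
  have hball := forall_mem_of_no_exit (y := y) (fun t ht => (hy t ht).2.continuousWithinAt)
    (O := Metric.ball 0 ρ) (N := Metric.closedBall 0 (D * ‖y t₀‖)) Metric.isOpen_ball
    Metric.isClosed_closedBall (Metric.closedBall_subset_ball hy₁)
    (mem_ball_zero_iff.2 hy₀) (fun τ hτ hin => by
      rw [mem_closedBall_zero_iff]
      refine (key τ hτ hin).trans ?_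
      have : Real.exp (-α * (τ - t₀)) ≤ 1 := by
        rw [Real.exp_le_one_iff]
        nlinarith [hτ.1]
      exact mul_le_of_le_one_right (by positivity) this)
  exact key t ht fun s hs => hball s ⟨hs.1, hs.2.trans ht.2⟩

/-- Chetaev's instability criterion for a quadratic form: if `0` is stable and the form is strictly
increasing along solutions near `0`, then it is nonpositive. -/
theorem form_nonpos_of_stable {n : ℕ} {F : E n → E n} {Ω : Set (E n)} (hΩ : IsOpen Ω)
    (h0 : (0 : E n) ∈ Ω) {K : ℝ≥0} (hF : LipschitzOnWith K F Ω) {B : ℝ}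
    (hB : ∀ x ∈ Ω, ‖F x‖ ≤ B) (hst : IsAsymptoticallyStable F Ω)
    (W : E n →L[ℝ] E n →L[ℝ] ℝ) (hWs : ∀ x y, W x y = W y x) {c : ℝ} (hc : 0 < c)
    (hW : ∀ᶠ x in 𝓝 (0 : E n), c * ‖x‖ ^ 2 ≤ W x (F x)) (x : E n) : W x x ≤ 0 := by
  by_contra! hx
  obtain ⟨η, hη, hηW⟩ := Metric.eventually_nhds_iff_ball.1 (hW.and (hΩ.mem_nhds h0))
  -- Stability at η / 2, strictly inside the ball where W increases, feeds the no-exit argument. The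
  -- solution itself comes from a global extension of F, since existence in Ω is not known
  -- beforehand.
  obtain ⟨ρ, hρ, hρs⟩ := hst.stable (η / 2) (by positivity)
  obtain ⟨G, K', B', hGL, hGB, hGF⟩ := exists_bounded_lipschitz_extension hF hB
  obtain ⟨s, hs, hsx⟩ : ∃ s : ℝ, 0 < s ∧ ‖s • x‖ < min ρ η := by
    refine ⟨min ρ η / (2 * (‖x‖ + 1)), by positivity, ?_⟩
    rw [norm_smul, Real.norm_of_nonneg (by positivity), div_mul_eq_mul_div,
      div_lt_iff₀ (by positivity)]
    have : 0 < min ρ η := lt_min hρ hη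
    nlinarith [norm_nonneg x]
  obtain ⟨y, hy0, hy⟩ := exists_solution_Ici hGL hGB (s • x)
  have hyc : ContinuousOn y (Ici 0) := fun t ht => (hy t ht).continuousWithinAt
  have hsol : ∀ τ, (∀ t ∈ Icc 0 τ, y t ∈ Metric.ball (0 : E n) η) →
      IsSolutionOn F Ω (Icc 0 τ) y := by
    intro τ hin t ht
    have hΩt := (hηW _ (hin t ht)).2
    exact ⟨hΩt, hGF hΩt ▸ (hy t ht.1).mono Icc_subset_Ici_self⟩
  have hin : ∀ T, ∀ t ∈ Icc 0 T, y t ∈ Metric.ball (0 : E n) η := by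
    intro T
    refine forall_mem_of_no_exit (hyc.mono Icc_subset_Ici_self)
      (N := Metric.closedBall 0 (η / 2)) Metric.isOpen_ball
      Metric.isClosed_closedBall (Metric.closedBall_subset_ball (by linarith))
      ?_ fun τ hτ hin => ?_
    · rw [hy0, mem_ball_zero_iff]
      exact hsx.trans_le (min_le_right _ _)
    · rw [mem_closedBall_zero_iff]
      exact (hρs τ y (hsol τ hin) (hy0 ▸ hsx.trans_le (min_le_left _ _)) τ ⟨hτ.1, le_rfl⟩).le
  -- `W` grows at least linearly along `y`, which is absurd since `y` is bounded
  set w₀ := W (s • x) (s • x) with hw₀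
  have hw₀pos : 0 < w₀ := by
    rw [hw₀]
    simp only [map_smul, smul_apply, smul_eq_mul]
    positivity
  have hWle : ∀ z : E n, W z z ≤ ‖W‖ * ‖z‖ ^ 2 := by
    intro z
    have := (le_abs_self _).trans (W.le_opNorm₂ z z)
    linarith [this, sq ‖z‖]
  have hgrow : ∀ T ≥ 0, w₀ + 2 * c * w₀ / (‖W‖ + 1) * T ≤ W (y T) (y T) := by
    intro T hT
    have hd : ∀ t ∈ Icc 0 T, HasDerivWithinAt (fun t => W (y t) (y t)) (2 * W (y t) (F (y t)))
        (Icc 0 T) t := fun t ht =>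
      hasDerivWithinAt_form W hWs (hsol T (hin T) t ht).2
    have hpos : ∀ t ∈ Icc 0 T, 2 * c * ‖y t‖ ^ 2 ≤ 2 * W (y t) (F (y t)) := fun t ht => by
      linarith [(hηW _ (hin T t ht)).1]
    have hmono : MonotoneOn (fun t => W (y t) (y t)) (Icc 0 T) :=
      monotoneOn_of_hasDerivWithinAt_nonneg (convex_Icc 0 T)
        (fun t ht => (hd t ht).continuousWithinAt)
        (fun t ht => (hd t (interior_subset ht)).mono interior_subset)
        (fun t ht => le_trans (by positivity) (hpos t (interior_subset ht)))
    -- As W(y, y) never falls below w₀ > 0, the solution stays away from 0, and so the derivative of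
    -- W(y, y) has a positive lower bound.
    have hlow : ∀ t ∈ Icc 0 T, w₀ / (‖W‖ + 1) ≤ ‖y t‖ ^ 2 := by
      intro t ht
      have h1 := hmono ⟨le_rfl, hT⟩ ht ht.1
      simp only [hy0] at h1
      rw [div_le_iff₀ (by positivity)]
      nlinarith [hWle (y t), sq_nonneg ‖y t‖]
    have hmono2 : MonotoneOn (fun t => W (y t) (y t) - 2 * c * w₀ / (‖W‖ + 1) * t) (Icc 0 T) := by
      have hd2 : ∀ t ∈ Icc 0 T, HasDerivWithinAt
          (fun t => W (y t) (y t) - 2 * c * w₀ / (‖W‖ + 1) * t)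
          (2 * W (y t) (F (y t)) - 2 * c * w₀ / (‖W‖ + 1)) (Icc 0 T) t := by
        intro t ht
        have := ((hasDerivAt_id t).const_mul (2 * c * w₀ / (‖W‖ + 1))).hasDerivWithinAt
          (s := Icc 0 T)
        rw [mul_one] at this
        exact (hd t ht).fun_sub this
      refine monotoneOn_of_hasDerivWithinAt_nonneg (convex_Icc 0 T)
        (fun t ht => (hd2 t ht).continuousWithinAt)
        (fun t ht => (hd2 t (interior_subset ht)).mono interior_subset)
        (fun t ht => ?_)
      have h2 := hpos t (interior_subset ht)
      have h3 := mul_le_mul_of_nonneg_left (hlow t (interior_subset ht))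
        (by positivity : 0 ≤ 2 * c)
      rw [← mul_div_assoc] at h3
      linarith
    have h4 := hmono2 ⟨le_rfl, hT⟩ ⟨hT, le_rfl⟩ hT
    simp only [hy0, mul_zero, sub_zero] at h4
    linarith
  have hslope : 0 < 2 * c * w₀ / (‖W‖ + 1) := by positivity
  obtain ⟨T, hT⟩ := exists_nat_gt (‖W‖ * η ^ 2 / (2 * c * w₀ / (‖W‖ + 1)))
  rw [div_lt_iff₀ hslope] at hT
  have h5 := hgrow T (Nat.cast_nonneg T)
  have h6 := mem_ball_zero_iff.1 (hin T T ⟨Nat.cast_nonneg T, le_rfl⟩)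
  have h7 : ‖W‖ * ‖y T‖ ^ 2 ≤ ‖W‖ * η ^ 2 := by gcongr
  linarith [hWle (y T)]

/-! ### Linearization at the origin -/

lemma norm_toEuclideanLin_le {a b : ℕ} (M : Matrix (Fin a) (Fin b) ℝ) (x : E b) :
    ‖Matrix.toEuclideanLin M x‖ ≤ ‖M‖ * ‖x‖ :=
  Matrix.l2_opNorm_mulVec M x

lemma tendsto_toEuclideanLin {a b : ℕ} {ι : Type*} {l : Filter ι}
    {M : ι → Matrix (Fin a) (Fin b) ℝ} {M₀ : Matrix (Fin a) (Fin b) ℝ} {z : ι → E b} {z₀ : E b}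
    (hM : Tendsto M l (𝓝 M₀)) (hz : Tendsto z l (𝓝 z₀)) :
    Tendsto (fun i => Matrix.toEuclideanLin (M i) (z i)) l
      (𝓝 (Matrix.toEuclideanLin M₀ z₀)) := by
  have h1 : Tendsto (fun i => ‖M i - M₀‖ * ‖z i‖ + ‖M₀‖ * ‖z i - z₀‖) l (𝓝 0) := by
    have := ((tendsto_iff_norm_sub_tendsto_zero.1 hM).mul hz.norm).add
      ((tendsto_iff_norm_sub_tendsto_zero.1 hz).const_mul ‖M₀‖)
    simpa using this
  refine tendsto_iff_norm_sub_tendsto_zero.2 (squeeze_zero (fun _ => norm_nonneg _) (fun i => ?_) h1)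
  have h2 : Matrix.toEuclideanLin (M i) (z i) - Matrix.toEuclideanLin M₀ z₀
      = Matrix.toEuclideanLin (M i - M₀) (z i) + Matrix.toEuclideanLin M₀ (z i - z₀) := by
    simp only [map_sub, LinearMap.sub_apply]
    abel
  rw [h2]
  exact (norm_add_le _ _).trans
    (add_le_add (norm_toEuclideanLin_le _ _) (norm_toEuclideanLin_le _ _))

lemma toEuclideanLin_mul_apply {a b c : ℕ} (M : Matrix (Fin a) (Fin b) ℝ)
    (N : Matrix (Fin b) (Fin c) ℝ) (x : E c) :
    Matrix.toEuclideanLin (M * N) x = Matrix.toEuclideanLin M (Matrix.toEuclideanLin N x) := by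
  simp [Matrix.toEuclideanLin]

lemma inner_toEuclideanLin_transpose {a b : ℕ} (M : Matrix (Fin a) (Fin b) ℝ) (x : E a) (y : E b) :
    ⟪x, Matrix.toEuclideanLin M y⟫_ℝ = ⟪Matrix.toEuclideanLin Mᵀ x, y⟫_ℝ := by
  rw [← Matrix.conjTranspose_eq_transpose_of_trivial,
    Matrix.toEuclideanLin_conjTranspose_eq_adjoint, LinearMap.adjoint_inner_left]

/-- A Lipschitz map on a bounded set containing the origin is bounded. -/
theorem exists_norm_le_of_lipschitzOnWith {n : ℕ} {X : Type*} [NormedAddCommGroup X] {h : E n → X}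
    {Ω : Set (E n)} (hb : Bornology.IsBounded Ω) (h0 : (0 : E n) ∈ Ω) {K : ℝ≥0}
    (hh : LipschitzOnWith K h Ω) : ∃ B > 0, ∀ x ∈ Ω, ‖h x‖ ≤ B := by
  obtain ⟨r, hr, hΩ⟩ := hb.exists_pos_norm_le
  refine ⟨‖h 0‖ + K * r + 1, by positivity, fun x hx => ?_⟩
  have h1 := hh.dist_le_mul x hx 0 h0
  rw [dist_eq_norm, dist_zero_right] at h1
  have h2 : (K : ℝ) * ‖x‖ ≤ K * r := by
    gcongr
    exact hΩ x hx
  linarith [norm_le_norm_add_norm_sub' (h x) (h 0)]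

lemma C1_remainder_zero {n : ℕ} {X : Type*} [NormedAddCommGroup X] {h : E n → X} {k : ℕ}
    (hk : k ≠ 0) (hh : h =O[𝓝 0] fun x => ‖x‖ ^ k) : h 0 = 0 := by
  obtain ⟨c, hc⟩ := hh.bound
  have := hc.self_of_nhds
  simpa [hk] using this

namespace ControlProblem

variable {n m : ℕ} {S : ControlProblem n m} {A Q P : Matrix (Fin n) (Fin n) ℝ}

lemma C1.f_zero (h : S.C1 A Q) : S.f 0 = 0 := by
  simpa using C1_remainder_zero two_ne_zero h.f_expansion

lemma C1.q_zero (h : S.C1 A Q) : S.q 0 = 0 := by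
  simpa using C1_remainder_zero three_ne_zero h.q_expansion

lemma C1.hasFDerivAt_f (h : S.C1 A Q) :
    HasFDerivAt S.f (Matrix.toEuclideanLin A).toContinuousLinearMap 0 := by
  have h1 : HasFDerivAt (fun x => S.f x - Matrix.toEuclideanLin A x) (0 : E n →L[ℝ] E n) 0 :=
    IsBigO.hasFDerivAt (n := 2) (by simpa using h.f_expansion) one_lt_two
  have h2 := h1.add (Matrix.toEuclideanLin A).toContinuousLinearMap.hasFDerivAt
  refine (h2.congr_fderiv (zero_add _)).congr_of_eventuallyEq (Eventually.of_forall fun x => ?_)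
  simp

/-- The quadratic part of the Hamilton-Jacobi equation. -/
theorem riccati_quadratic (hΩ_open : IsOpen S.Ω) (hΩ_zero : (0 : E n) ∈ S.Ω) (hC1 : S.C1 A Q)
    {V : E n → ℝ} (hV : S.IsStabilizingSolution V)
    (hP : HasFDerivAt (gradient V) (Matrix.toEuclideanLin P).toContinuousLinearMap 0)
    {L : ℝ≥0} (hLR : LipschitzOnWith L S.R S.Ω) (v : E n) :
    ⟪Matrix.toEuclideanLin P v, Matrix.toEuclideanLin A v⟫_ℝ
      - 1 / 2 * ⟪Matrix.toEuclideanLin P v,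
          Matrix.toEuclideanLin (S.R 0) (Matrix.toEuclideanLin P v)⟫_ℝ
      + 1 / 2 * ⟪v, Matrix.toEuclideanLin Q v⟫_ℝ = 0 := by
  -- Evaluate the Hamilton-Jacobi equation at s v, divide by s² and let s → 0, one factor s⁻¹ going
  -- to each of the two vectors in an inner product. Of R, only continuity at 0 enters.
  have hp : Tendsto (fun s : ℝ => s⁻¹ • gradient V (s • v)) (𝓝[≠] 0)
      (𝓝 (Matrix.toEuclideanLin P v)) := by
    simpa [hV.gradient_zero] using (hP.hasLineDerivAt v).tendsto_slope_zero
  have hf : Tendsto (fun s : ℝ => s⁻¹ • S.f (s • v)) (𝓝[≠] 0)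
      (𝓝 (Matrix.toEuclideanLin A v)) := by
    simpa [hC1.f_zero] using (hC1.hasFDerivAt_f.hasLineDerivAt v).tendsto_slope_zero
  have hs0 : Tendsto (fun s : ℝ => s • v) (𝓝[≠] 0) (𝓝 0) := by
    have : Continuous fun s : ℝ => s • v := by fun_prop
    exact (this.tendsto' 0 0 (zero_smul _ _)).mono_left nhdsWithin_le_nhds
  have hR : Tendsto (fun s : ℝ => S.R (s • v)) (𝓝[≠] 0) (𝓝 (S.R 0)) :=
    (hLR.continuousOn.continuousAt (hΩ_open.mem_nhds hΩ_zero)).tendsto.comp hs0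
  have hq : Tendsto (fun s : ℝ => (s ^ 2)⁻¹ * S.q (s • v)) (𝓝[≠] 0)
      (𝓝 (1 / 2 * ⟪v, Matrix.toEuclideanLin Q v⟫_ℝ)) := by
    have h1 : (fun s : ℝ => S.q (s • v)
        - 1 / 2 * ⟪s • v, Matrix.toEuclideanLin Q (s • v)⟫_ℝ) =O[𝓝[≠] 0] fun s => ‖s • v‖ ^ 3 :=
      hC1.q_expansion.comp_tendsto hs0
    obtain ⟨c, hc⟩ := h1.bound
    rw [tendsto_iff_norm_sub_tendsto_zero]
    have h2 : Tendsto (fun s : ℝ => c * (|s| * ‖v‖ ^ 3)) (𝓝[≠] 0) (𝓝 0) := by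
      have : Continuous fun s : ℝ => c * (|s| * ‖v‖ ^ 3) := by fun_prop
      exact (this.tendsto' 0 0 (by simp)).mono_left nhdsWithin_le_nhds
    refine squeeze_zero' (Eventually.of_forall fun _ => norm_nonneg _) ?_ h2
    filter_upwards [hc, self_mem_nhdsWithin] with s hs hs'
    have hs1 : s ≠ 0 := hs'
    have hs2 : 0 < |s| := abs_pos.2 hs1
    have h3 : (s ^ 2)⁻¹ * S.q (s • v) - 1 / 2 * ⟪v, Matrix.toEuclideanLin Q v⟫_ℝ
        = (s ^ 2)⁻¹ * (S.q (s • v) - 1 / 2 * ⟪s • v, Matrix.toEuclideanLin Q (s • v)⟫_ℝ) := by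
      rw [map_smul, real_inner_smul_left, real_inner_smul_right]
      field_simp
    rw [h3, norm_mul, norm_inv, norm_pow, Real.norm_eq_abs s, inv_mul_le_iff₀ (by positivity)]
    refine hs.trans_eq ?_
    rw [norm_pow, norm_norm, norm_smul, Real.norm_eq_abs]
    ring
  have hRp : Tendsto (fun s : ℝ => Matrix.toEuclideanLin (S.R (s • v)) (s⁻¹ • gradient V (s • v)))
      (𝓝[≠] 0) (𝓝 (Matrix.toEuclideanLin (S.R 0) (Matrix.toEuclideanLin P v))) :=
    tendsto_toEuclideanLin hR hp
  have hlim := ((hp.inner hf).sub ((hp.inner hRp).const_mul (1 / 2 : ℝ))).add hq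
  refine tendsto_nhds_unique hlim (tendsto_const_nhds.congr' ?_)
  filter_upwards [hs0.eventually (hΩ_open.mem_nhds hΩ_zero), self_mem_nhdsWithin] with s hs hs'
  have hs1 : s ≠ 0 := hs'
  have h4 := hV.hamiltonJacobi _ hs
  simp only [map_smul, real_inner_smul_left, real_inner_smul_right]
  have h5 : s⁻¹ * (s⁻¹ * ⟪gradient V (s • v), S.f (s • v)⟫_ℝ)
      - 1 / 2 * (s⁻¹ * (s⁻¹ * ⟪gradient V (s • v),
          Matrix.toEuclideanLin (S.R (s • v)) (gradient V (s • v))⟫_ℝ))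
      + (s ^ 2)⁻¹ * S.q (s • v) = (s ^ 2)⁻¹ * (⟪gradient V (s • v), S.f (s • v)⟫_ℝ
        - 1 / 2 * ⟪gradient V (s • v),
          Matrix.toEuclideanLin (S.R (s • v)) (gradient V (s • v))⟫_ℝ + S.q (s • v)) := by
    field_simp
  rw [h5, h4, mul_zero]

/-- The Hessian is symmetric. -/
theorem isSymm_hessian {Ω : Set (E n)} (hΩ_open : IsOpen Ω) (hΩ_zero : (0 : E n) ∈ Ω)
    {V : E n → ℝ} (hV : ∀ x ∈ Ω, DifferentiableAt ℝ V x)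
    (hP : HasFDerivAt (gradient V) (Matrix.toEuclideanLin P).toContinuousLinearMap 0) :
    P.IsSymm := by
  let ι : E n →L[ℝ] E n →L[ℝ] ℝ :=
    (isBoundedBilinearMap_inner (𝕜 := ℝ) (E := E n)).toContinuousLinearMap
  have h1 : ∀ᶠ y in 𝓝 (0 : E n), HasFDerivAt V (ι (gradient V y)) y := by
    filter_upwards [hΩ_open.mem_nhds hΩ_zero] with y hy
    exact (hV y hy).hasGradientAt.hasFDerivAt
  have h2 : HasFDerivAt (fun y => ι (gradient V y))
      (ι ∘L (Matrix.toEuclideanLin P).toContinuousLinearMap) 0 :=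
    ι.hasFDerivAt.comp 0 hP
  -- Symmetry of the second derivative at a point needs only a first derivative nearby that is
  -- differentiable at that point; `ι` turns gradients into differentials.
  have h3 := second_derivative_symmetric_of_eventually_of_real h1 h2
  have h4 : (Matrix.toEuclideanLin P).IsSymmetric := by
    intro v w
    have : ⟪Matrix.toEuclideanLin P v, w⟫_ℝ = ⟪Matrix.toEuclideanLin P w, v⟫_ℝ := h3 v w
    rw [this, real_inner_comm]
  rw [Matrix.isSymmetric_toEuclideanLin_iff] at h4
  rwa [Matrix.IsHermitian, Matrix.conjTranspose_eq_transpose_of_trivial] at h4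

lemma isSymm_R (S : ControlProblem n m) (x : E n) : (S.R x).IsSymm := by
  simp [Matrix.IsSymm, R, Matrix.transpose_mul]

/-- The algebraic Riccati equation. -/
theorem riccati (hP : P.IsSymm) (hQ : Q.IsSymm)
    (h : ∀ v : E n, ⟪Matrix.toEuclideanLin P v, Matrix.toEuclideanLin A v⟫_ℝ
      - 1 / 2 * ⟪Matrix.toEuclideanLin P v,
          Matrix.toEuclideanLin (S.R 0) (Matrix.toEuclideanLin P v)⟫_ℝ
      + 1 / 2 * ⟪v, Matrix.toEuclideanLin Q v⟫_ℝ = 0) :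
    -Q - Aᵀ * P = P * (A - S.R 0 * P) := by
  -- The Riccati residual is symmetric, so the vanishing of its quadratic form makes it zero.
  let X := P * A + Aᵀ * P - P * (S.R 0 * P) + Q
  have hX : X.IsHermitian := by
    rw [Matrix.IsHermitian, Matrix.conjTranspose_eq_transpose_of_trivial]
    simp only [X, Matrix.transpose_add, Matrix.transpose_sub, Matrix.transpose_mul,
      Matrix.transpose_transpose, hP.eq, hQ.eq, (S.isSymm_R 0).eq, Matrix.mul_assoc]
    abel
  have h0 : Matrix.toEuclideanLin X = 0 := by
    rw [← (Matrix.isSymmetric_toEuclideanLin_iff.2 hX).inner_map_self_eq_zero]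
    intro v
    have h1 := h v
    rw [real_inner_comm]
    have e1 : ⟪v, Matrix.toEuclideanLin (P * A) v⟫_ℝ
        = ⟪Matrix.toEuclideanLin P v, Matrix.toEuclideanLin A v⟫_ℝ := by
      rw [toEuclideanLin_mul_apply, inner_toEuclideanLin_transpose, hP.eq]
    have e2 : ⟪v, Matrix.toEuclideanLin (Aᵀ * P) v⟫_ℝ
        = ⟪Matrix.toEuclideanLin P v, Matrix.toEuclideanLin A v⟫_ℝ := by
      rw [toEuclideanLin_mul_apply, inner_toEuclideanLin_transpose, Matrix.transpose_transpose,
        real_inner_comm]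
    have e3 : ⟪v, Matrix.toEuclideanLin (P * (S.R 0 * P)) v⟫_ℝ = ⟪Matrix.toEuclideanLin P v,
          Matrix.toEuclideanLin (S.R 0) (Matrix.toEuclideanLin P v)⟫_ℝ := by
      rw [toEuclideanLin_mul_apply, toEuclideanLin_mul_apply, inner_toEuclideanLin_transpose, hP.eq]
    simp only [X, map_add, map_sub, LinearMap.add_apply, LinearMap.sub_apply, inner_add_right,
      inner_sub_right, e1, e2, e3]
    linarith
  have hX0 : X = 0 := Matrix.toEuclideanLin.map_eq_zero_iff.1 h0
  have : P * (A - S.R 0 * P) - (-Q - Aᵀ * P) = X := by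
    simp only [X, Matrix.mul_sub]
    abel
  rw [hX0, sub_eq_zero] at this
  exact this.symm

/-- The graph of `P` is invariant under the Hamiltonian matrix, hence the closed-loop matrix is
hyperbolic. -/
theorem isHyperbolic_closedLoop (hH : IsHyperbolic (S.Ham A Q))
    (hric : -Q - Aᵀ * P = P * (A - S.R 0 * P)) : IsHyperbolic (A - S.R 0 * P) := by
  intro μ hμ
  refine hH μ ?_
  obtain ⟨v, hv⟩ := hμ.exists_hasEigenvector
  have hv1 := hv.apply_eq_smul
  set c : ℝ →+* ℂ := algebraMap ℝ ℂ with hc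
  -- An eigenvector v of the closed-loop matrix lifts to (v, Pv): the upper block row is the
  -- eigenvalue equation, the lower one is the Riccati equation.
  have key : Matrix.toLin' ((S.Ham A Q).map c) (Sum.elim v (P.map c *ᵥ v))
      = μ • Sum.elim v (P.map c *ᵥ v) := by
    have h1 : (A.map c - (S.R 0).map c * P.map c) *ᵥ v = μ • v := by
      rw [Matrix.toLin'_apply] at hv1
      rw [← hv1, Matrix.map_sub _ (map_sub c), Matrix.map_mul]
    have h2 : (-Q.map c - (Aᵀ).map c * P.map c) *ᵥ v = μ • (P.map c *ᵥ v) := by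
      have h3 := congrArg (fun M : Matrix (Fin n) (Fin n) ℝ => M.map c) hric
      simp only [Matrix.map_sub _ (map_sub c), Matrix.map_mul, Matrix.map_neg _ (map_neg c)] at h3
      rw [h3, ← Matrix.mulVec_mulVec, h1, Matrix.mulVec_smul]
    rw [Matrix.toLin'_apply, Ham, Matrix.fromBlocks_map, Matrix.fromBlocks_mulVec]
    simp only [Sum.elim_comp_inl, Sum.elim_comp_inr, Matrix.map_neg _ (map_neg c)]
    rw [Matrix.sub_mulVec, ← Matrix.mulVec_mulVec] at h1 h2
    ext (j | j)
    · have := congrFun h1 j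
      simp only [Pi.sub_apply, Pi.smul_apply] at this
      simp only [Sum.elim_inl, Pi.add_apply, Pi.smul_apply, Matrix.neg_mulVec, Pi.neg_apply]
      rw [← this]
      ring
    · have := congrFun h2 j
      simp only [Pi.sub_apply, Pi.smul_apply] at this
      simp only [Sum.elim_inr, Pi.add_apply, Pi.smul_apply, Matrix.neg_mulVec, Pi.neg_apply] at this ⊢
      rw [← this]
      ring
  refine Module.End.hasEigenvalue_of_hasEigenvector
    (x := Sum.elim v (P.map c *ᵥ v)) ⟨Module.End.mem_eigenspace_iff.2 key, fun h0 => hv.2 ?_⟩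
  ext j
  exact congrFun h0 (Sum.inl j)

/-- The distance of the closed-loop field of a costate map to the linearized field. -/
theorem norm_closedLoop_sub_le {L : ℝ≥0} (hΩ_zero : (0 : E n) ∈ S.Ω)
    (hLR : LipschitzOnWith L S.R S.Ω) (p : E n → E n)
    {x : E n} (hx : x ∈ S.Ω) :
    ‖S.closedLoop p x - Matrix.toEuclideanLin (A - S.R 0 * P) x‖
      ≤ ‖S.f x - Matrix.toEuclideanLin A x‖ + ‖S.R x‖ * ‖p x - Matrix.toEuclideanLin P x‖
        + L * ‖P‖ * ‖x‖ ^ 2 := by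
  have h1 : S.closedLoop p x - Matrix.toEuclideanLin (A - S.R 0 * P) x
      = (S.f x - Matrix.toEuclideanLin A x)
        - Matrix.toEuclideanLin (S.R x) (p x - Matrix.toEuclideanLin P x)
        - Matrix.toEuclideanLin (S.R x - S.R 0) (Matrix.toEuclideanLin P x) := by
    simp only [closedLoop, map_sub, LinearMap.sub_apply, toEuclideanLin_mul_apply]
    abel
  have h2 : ‖S.R x - S.R 0‖ ≤ L * ‖x‖ := by
    simpa [dist_eq_norm] using hLR.dist_le_mul x hx 0 hΩ_zero
  rw [h1]
  refine (norm_sub_le _ _).trans (add_le_add ((norm_sub_le _ _).trans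
    (add_le_add le_rfl (norm_toEuclideanLin_le _ _))) ?_)
  calc _ ≤ ‖S.R x - S.R 0‖ * (‖P‖ * ‖x‖) :=
        (norm_toEuclideanLin_le _ _).trans (by gcongr; exact norm_toEuclideanLin_le _ _)
    _ ≤ L * ‖x‖ * (‖P‖ * ‖x‖) := by gcongr
    _ = _ := by ring

/-- The closed-loop field of a Lipschitz costate map is Lipschitz. -/
theorem norm_closedLoop_sub_closedLoop_le {L K : ℝ≥0} {B_R B_p : ℝ}
    (hLf : LipschitzOnWith L S.f S.Ω) (hLR : LipschitzOnWith L S.R S.Ω)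
    (hBR : ∀ x ∈ S.Ω, ‖S.R x‖ ≤ B_R) {p : E n → E n} (hp : LipschitzOnWith K p S.Ω)
    (hBp : ∀ x ∈ S.Ω, ‖p x‖ ≤ B_p) {x y : E n} (hx : x ∈ S.Ω) (hy : y ∈ S.Ω) :
    ‖S.closedLoop p x - S.closedLoop p y‖ ≤ (L + B_R * K + L * B_p) * ‖x - y‖ := by
  have h1 : S.closedLoop p x - S.closedLoop p y = (S.f x - S.f y)
      - Matrix.toEuclideanLin (S.R x) (p x - p y)
      - Matrix.toEuclideanLin (S.R x - S.R y) (p y) := by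
    simp only [closedLoop, map_sub, LinearMap.sub_apply]
    abel
  have hf := hLf.dist_le_mul x hx y hy
  have hR := hLR.dist_le_mul x hx y hy
  have hp' := hp.dist_le_mul x hx y hy
  rw [dist_eq_norm, dist_eq_norm] at hf hR hp'
  have e1 : ‖Matrix.toEuclideanLin (S.R x) (p x - p y)‖ ≤ B_R * (K * ‖x - y‖) :=
    (norm_toEuclideanLin_le _ _).trans
      (mul_le_mul (hBR x hx) hp' (norm_nonneg _) ((norm_nonneg _).trans (hBR x hx)))
  have e2 : ‖Matrix.toEuclideanLin (S.R x - S.R y) (p y)‖ ≤ L * ‖x - y‖ * B_p :=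
    (norm_toEuclideanLin_le _ _).trans
      (mul_le_mul hR (hBp y hy) (norm_nonneg _) (by positivity))
  rw [h1]
  calc _ ≤ ‖S.f x - S.f y‖ + ‖Matrix.toEuclideanLin (S.R x) (p x - p y)‖
        + ‖Matrix.toEuclideanLin (S.R x - S.R y) (p y)‖ :=
        (norm_sub_le _ _).trans (add_le_add (norm_sub_le _ _) le_rfl)
    _ ≤ L * ‖x - y‖ + B_R * (K * ‖x - y‖) + L * ‖x - y‖ * B_p := by gcongr
    _ = _ := by ring

end ControlProblem

lemma form_perturbation_le {n : ℕ} (U : E n →L[ℝ] E n →L[ℝ] ℝ) {x z w : E n} {e : ℝ}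
    (h : ‖z - w‖ ≤ e * ‖x‖) : |U x z - U x w| ≤ ‖U‖ * e * ‖x‖ ^ 2 := by
  rw [← map_sub]
  calc |U x (z - w)| ≤ ‖U‖ * ‖x‖ * ‖z - w‖ := U.le_opNorm₂ _ _
    _ ≤ ‖U‖ * ‖x‖ * (e * ‖x‖) := by gcongr
    _ = _ := by ring

namespace ControlProblem

variable {n m : ℕ} {S : ControlProblem n m} {A Q P : Matrix (Fin n) (Fin n) ℝ}

/-- The closed-loop field of a costate map with derivative `P` at the origin is differentiable at
the origin, with derivative `A - R(0) P`. -/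
theorem eventually_norm_closedLoop_sub_le {L : ℝ≥0} (hΩ_open : IsOpen S.Ω)
    (hΩ_zero : (0 : E n) ∈ S.Ω) (hC1 : S.C1 A Q) (hLR : LipschitzOnWith L S.R S.Ω)
    {B : ℝ} (hB : 0 < B) (hBR : ∀ x ∈ S.Ω, ‖S.R x‖ ≤ B) {p : E n → E n} (hp0 : p 0 = 0)
    (hP : HasFDerivAt p (Matrix.toEuclideanLin P).toContinuousLinearMap 0) {e : ℝ} (he : 0 < e) :
    ∀ᶠ x in 𝓝 (0 : E n),
      ‖S.closedLoop p x - Matrix.toEuclideanLin (A - S.R 0 * P) x‖ ≤ e * ‖x‖ := by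
  have h1 : ∀ᶠ x in 𝓝 (0 : E n), ‖S.f x - Matrix.toEuclideanLin A x‖ ≤ e / 3 * ‖x‖ := by
    have := hC1.hasFDerivAt_f.isLittleO.def (c := e / 3) (by positivity)
    simpa [hC1.f_zero] using this
  have h2 : ∀ᶠ x in 𝓝 (0 : E n), ‖p x - Matrix.toEuclideanLin P x‖ ≤ e / 3 / B * ‖x‖ := by
    have := hP.isLittleO.def (c := e / 3 / B) (by positivity)
    simpa [hp0] using this
  have h3 : ∀ᶠ x in 𝓝 (0 : E n), L * ‖P‖ * ‖x‖ < e / 3 := by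
    have : Continuous fun x : E n => L * ‖P‖ * ‖x‖ := by fun_prop
    exact this.continuousAt.eventually_lt_const (by simpa using he)
  filter_upwards [h1, h2, h3, hΩ_open.mem_nhds hΩ_zero] with x h1 h2 h3 hx
  have h4 := norm_closedLoop_sub_le (A := A) (P := P) hΩ_zero hLR p hx
  have h5 : ‖S.R x‖ * ‖p x - Matrix.toEuclideanLin P x‖ ≤ B * (e / 3 / B * ‖x‖) :=
    mul_le_mul (hBR x hx) h2 (norm_nonneg _) hB.le
  have h6 : B * (e / 3 / B * ‖x‖) = e / 3 * ‖x‖ := by field_simp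
  nlinarith [norm_nonneg x, mul_le_mul_of_nonneg_right h3.le (norm_nonneg x)]

/-- Asymptotic stability of the hyperbolic closed loop yields a quadratic Lyapunov function. -/
theorem exists_lyapunov_form {L : ℝ≥0} (hΩ_open : IsOpen S.Ω) (hΩ_bdd : Bornology.IsBounded S.Ω)
    (hΩ_zero : (0 : E n) ∈ S.Ω) (hC1 : S.C1 A Q) (hC2 : S.C2 A Q) {V : E n → ℝ}
    (hV : S.IsStabilizingSolution V)
    (hP : HasFDerivAt (gradient V) (Matrix.toEuclideanLin P).toContinuousLinearMap 0)
    (hLf : LipschitzOnWith L S.f S.Ω) (hLR : LipschitzOnWith L S.R S.Ω)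
    (hLp : LipschitzOnWith L (gradient V) S.Ω) :
    ∃ U : E n →L[ℝ] E n →L[ℝ] ℝ, (∀ x y, U x y = U y x) ∧ (∃ a > 0, ∀ x, a * ‖x‖ ^ 2 ≤ U x x) ∧
      ∃ c > 0, ∀ x, U x (Matrix.toEuclideanLin (A - S.R 0 * P) x) ≤ -(c * ‖x‖ ^ 2) := by
  have hhyp : IsHyperbolic (A - S.R 0 * P) :=
    isHyperbolic_closedLoop hC2.hyperbolic (riccati
      (isSymm_hessian hΩ_open hΩ_zero hV.differentiable hP) hC1.Q_symm
      (riccati_quadratic hΩ_open hΩ_zero hC1 hV hP hLR))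
  obtain ⟨W, hWs, c, hc, hW⟩ := hhyp.exists_form_pos
  obtain ⟨B_R, hBR0, hBR⟩ := exists_norm_le_of_lipschitzOnWith hΩ_bdd hΩ_zero hLR
  obtain ⟨B_p, hBp0, hBp⟩ := exists_norm_le_of_lipschitzOnWith hΩ_bdd hΩ_zero hLp
  have hlip : LipschitzOnWith (L + B_R.toNNReal * L + L * B_p.toNNReal)
      (S.closedLoop (gradient V)) S.Ω := by
    refine LipschitzOnWith.of_dist_le_mul fun x hx y hy => ?_
    rw [dist_eq_norm, dist_eq_norm]
    have := norm_closedLoop_sub_closedLoop_le hLf hLR hBR hLp hBp hx hy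
    simpa [Real.coe_toNNReal _ hBR0.le, Real.coe_toNNReal _ hBp0.le] using this
  obtain ⟨B, -, hB⟩ := exists_norm_le_of_lipschitzOnWith hΩ_bdd hΩ_zero hlip
  -- This error size costs at most half of c, so W (x, F x) ≥ (c/2) ‖x‖² for the nonlinear field
  -- near 0.
  have hev := eventually_norm_closedLoop_sub_le hΩ_open hΩ_zero hC1 hLR hBR0 hBR hV.gradient_zero hP
    (e := c / 2 / (‖W‖ + 1)) (by positivity)
  have hneg := form_nonpos_of_stable hΩ_open hΩ_zero hlip hB hV.stable W hWs (c := c / 2)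
    (by positivity) (by
      filter_upwards [hev] with x hx
      have h1 := (abs_le.1 (form_perturbation_le W hx)).1
      have h2 : ‖W‖ * (c / 2 / (‖W‖ + 1)) ≤ c / 2 := by
        rw [mul_div_assoc', div_le_iff₀ (by positivity)]
        nlinarith [norm_nonneg W]
      nlinarith [hW x, mul_le_mul_of_nonneg_right h2 (sq_nonneg ‖x‖)])
  obtain ⟨a, ha, haW⟩ := negDef_of_nonpos W hWs
    (Matrix.toEuclideanLin (A - S.R 0 * P)).toContinuousLinearMap hc hW hneg
  exact ⟨-W, fun x y => by simp [hWs x y], ⟨a, ha, haW⟩, c, hc, fun x => neg_le_neg (hW x)⟩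

end ControlProblem

/-- A quadratic Lyapunov function for a linear field bounds the matrix exponential. -/
theorem norm_exp_le_of_lyapunov {n : ℕ} {M : Matrix (Fin n) (Fin n) ℝ}
    {U : E n →L[ℝ] E n →L[ℝ] ℝ} (hU : ∀ x y, U x y = U y x) {a b D α : ℝ} (ha : 0 < a) (hD : 0 ≤ D)
    (hα : 0 ≤ α) (hbD : b ≤ D ^ 2 * a)
    (hUa : ∀ x, a * ‖x‖ ^ 2 ≤ U x x) (hUb : ∀ x, U x x ≤ b * ‖x‖ ^ 2)
    (hM : ∀ x, U x (Matrix.toEuclideanLin M x) ≤ -α * U x x) {t : ℝ} (ht : 0 ≤ t) :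
    ‖NormedSpace.exp (t • M)‖ ≤ D * Real.exp (-(α * t)) := by
  rw [Matrix.l2_opNorm_def]
  refine ContinuousLinearMap.opNorm_le_bound _ (by positivity) fun x => ?_
  let Λ : Matrix (Fin n) (Fin n) ℝ →L[ℝ] E n := LinearMap.toContinuousLinearMap
    ((LinearMap.applyₗ x) ∘ₗ (Matrix.toEuclideanLin (𝕜 := ℝ) (m := Fin n) (n := Fin n)).toLinearMap)
  have hΛ : ∀ N, Λ N = Matrix.toEuclideanLin N x := fun _ => rfl
  have hsol : IsSolutionOn (fun z => Matrix.toEuclideanLin M z) univ (Icc 0 t)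
      (fun s => Λ (NormedSpace.exp (s • M))) := by
    intro s _
    refine ⟨mem_univ _, ?_⟩
    have h1 := Λ.hasFDerivAt.comp_hasDerivAt s (hasDerivAt_exp_smul_const' (𝕂 := ℝ) M s)
    rw [hΛ, toEuclideanLin_mul_apply] at h1
    exact h1.hasDerivWithinAt
  have h0 : Λ (NormedSpace.exp ((0 : ℝ) • M)) = x := by
    rw [zero_smul, NormedSpace.exp_zero, hΛ]
    simp [Matrix.toEuclideanLin]
  -- For a linear field the Lyapunov inequality is global, so any radius exceeding ‖x‖ and D ‖x‖
  -- will do.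
  have h2 := norm_le_mul_exp_of_lyapunov hU (ρ := ‖x‖ + D * ‖x‖ + 1) ha hD hα hbD hUa hUb
    (fun x _ _ => hM x) hsol
    (by simp only [h0]; nlinarith [norm_nonneg x, mul_nonneg hD (norm_nonneg x)])
    (by simp only [h0]; nlinarith [norm_nonneg x]) t ⟨ht, le_rfl⟩
  simp only [h0, sub_zero] at h2
  rw [hΛ] at h2
  calc _ ≤ D * ‖x‖ * Real.exp (-α * t) := h2
    _ = _ := by rw [neg_mul]; ring

/-! ### Smoothness of the network -/

lemma contDiff_mulVec {F : Type*} [NormedAddCommGroup F] [NormedSpace ℝ F] {a b : ℕ}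
    (M : Matrix (Fin a) (Fin b) ℝ) {h : F → Fin b → ℝ} (hh : ContDiff ℝ 1 h) :
    ContDiff ℝ 1 fun x => M *ᵥ h x :=
  (LinearMap.toContinuousLinearMap (Matrix.mulVecLin M)).contDiff.comp hh

namespace NetParams

variable {n depth width : ℕ} (θ : NetParams n depth width)

lemma contDiff_act {F : Type*} [NormedAddCommGroup F] [NormedSpace ℝ F] {h : F → Fin width → ℝ}
    (hh : ContDiff ℝ 1 h) : ContDiff ℝ 1 fun x => act (h x) :=
  contDiff_pi.2 fun j => (contDiff_pi.1 hh j).sin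

lemma contDiff_ofLp : ContDiff ℝ 1 fun x : E n => x.ofLp :=
  PiLp.contDiff_ofLp

lemma contDiff_state (i : Fin (depth + 1)) : ContDiff ℝ 1 fun x => θ.state x i := by
  induction i using Fin.induction with
  | zero =>
    exact contDiff_act ((contDiff_mulVec _ contDiff_ofLp).add contDiff_const)
  | succ i ih =>
    have hgate : ∀ (M : Matrix (Fin width) (Fin n) ℝ) (N : Matrix (Fin width) (Fin width) ℝ)
        (v : Fin width → ℝ) {h : E n → Fin width → ℝ}, ContDiff ℝ 1 h →
        ContDiff ℝ 1 fun x : E n => act (M *ᵥ x.ofLp + N *ᵥ h x + v) := fun M N v h hh =>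
      contDiff_act (((contDiff_mulVec M contDiff_ofLp).add (contDiff_mulVec N hh)).add
        contDiff_const)
    have hmul : ∀ {h k : E n → Fin width → ℝ}, ContDiff ℝ 1 h → ContDiff ℝ 1 k →
        ContDiff ℝ 1 fun x => h x * k x := fun hh hk =>
      contDiff_pi.2 fun j => (contDiff_pi.1 hh j).mul (contDiff_pi.1 hk j)
    have hlayer : ContDiff ℝ 1 fun x => θ.layer x i (θ.state x i.castSucc) :=
      (hmul (contDiff_const.sub (hgate _ _ _ ih))
        (hgate _ _ _ (hmul ih (hgate _ _ _ ih)))).add (hmul (hgate _ _ _ ih) ih)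
    exact hlayer

theorem contDiff_eval : ContDiff ℝ 1 θ.eval :=
  PiLp.contDiff_toLp.comp
    ((contDiff_mulVec θ.W (θ.contDiff_state (Fin.last depth))).add contDiff_const)

/-- A network is Lipschitz on bounded sets. -/
theorem exists_lipschitzOnWith_eval {Ω : Set (E n)} (hΩ : Bornology.IsBounded Ω) :
    ∃ K, LipschitzOnWith K θ.eval Ω := by
  obtain ⟨r, hr⟩ := hΩ.subset_closedBall 0
  obtain ⟨K, hK⟩ := θ.contDiff_eval.contDiffOn.exists_lipschitzOnWith one_ne_zero
    (convex_closedBall (0 : E n) r) (isCompact_closedBall 0 r)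
  exact ⟨K, hK.mono hr⟩

end NetParams

/-! ### Grönwall comparison of two fields -/

lemma IsSolutionOn.mono {n : ℕ} {F : E n → E n} {Ω : Set (E n)} {s s' : Set ℝ} {x : ℝ → E n}
    (h : IsSolutionOn F Ω s x) (hs : s' ⊆ s) : IsSolutionOn F Ω s' x :=
  fun t ht => ⟨(h t (hs ht)).1, (h t (hs ht)).2.mono hs⟩

lemma IsSolutionOn.continuousOn {n : ℕ} {F : E n → E n} {Ω : Set (E n)} {s : Set ℝ} {x : ℝ → E n}
    (h : IsSolutionOn F Ω s x) : ContinuousOn x s :=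
  fun t ht => (h t ht).2.continuousWithinAt

/-- Grönwall's estimate for solutions of two close vector fields. -/
theorem norm_sub_le_of_close_fields {n : ℕ} {F F' : E n → E n} {Ω : Set (E n)} {K l e C : ℝ}
    (hK : 0 < K) (hKl : K ≤ l) (hC : 0 ≤ C) (he : e ≤ C * K)
    (hF : ∀ z ∈ Ω, ∀ w ∈ Ω, ‖F z - F w‖ ≤ K * ‖z - w‖)
    (hFF' : ∀ z ∈ Ω, ‖F' z - F z‖ ≤ e) {τ : ℝ} {x y : ℝ → E n}
    (hx : IsSolutionOn F Ω (Icc 0 τ) x) (hy : IsSolutionOn F' Ω (Icc 0 τ) y) (h0 : y 0 = x 0) :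
    ∀ t ∈ Icc 0 τ, ‖y t - x t‖ ≤ C * Real.exp (l * t) := by
  intro t ht
  have h1 := dist_le_of_approx_trajectories_ODE_of_mem (v := fun _ => F) (s := fun _ => Ω)
    (K := ⟨K, hK.le⟩) (εf := e) (εg := 0) (δ := 0)
    (fun _ _ => LipschitzOnWith.of_dist_le_mul fun z hz w hw => by
      rw [dist_eq_norm, dist_eq_norm]; exact hF z hz w hw)
    hy.continuousOn
    (fun t ht => hasDerivWithinAt_Ici_of_Icc ht (hy t (Ico_subset_Icc_self ht)).2)
    (fun t ht => by
      rw [dist_eq_norm]; exact hFF' _ (hy t (Ico_subset_Icc_self ht)).1)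
    (fun t ht => (hy t (Ico_subset_Icc_self ht)).1)
    hx.continuousOn
    (fun t ht => hasDerivWithinAt_Ici_of_Icc ht (hx t (Ico_subset_Icc_self ht)).2)
    (fun t ht => (dist_self _).le)
    (fun t ht => (hx t (Ico_subset_Icc_self ht)).1)
    (by rw [h0, dist_self]) t ht
  rw [dist_eq_norm, add_zero, sub_zero, gronwallBound_of_K_ne_0 (by exact hK.ne')] at h1
  simp only [zero_mul, zero_add] at h1
  have h2 : 1 ≤ Real.exp (K * t) := Real.one_le_exp (mul_nonneg hK.le ht.1)
  have h3 : Real.exp (K * t) ≤ Real.exp (l * t) :=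
    Real.exp_le_exp.2 (mul_le_mul_of_nonneg_right hKl ht.1)
  have h4 : e / K ≤ C := by rwa [div_le_iff₀ hK]
  calc ‖y t - x t‖ ≤ e / K * (Real.exp (K * t) - 1) := h1
    _ ≤ C * (Real.exp (K * t) - 1) := mul_le_mul_of_nonneg_right h4 (by linarith)
    _ ≤ C * Real.exp (l * t) := mul_le_mul_of_nonneg_left (by linarith) hC

/-! ### Improper integrals with exponential tails -/

/-- A continuous function with an exponentially decaying tail is integrable, and its tail integral
is small. -/
theorem integrableOn_and_tail_le {c : ℝ → ℝ} (hc : ContinuousOn c (Ici 0)) {T a α : ℝ} (hT : 0 < T)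
    (hα : 0 < α) (h : ∀ t > T, |c t| ≤ a * Real.exp (-(α * (t - T)))) :
    MeasureTheory.IntegrableOn c (Ioi 0) ∧ |∫ t in Ioi T, c t| ≤ a / α := by
  have hexp : ∀ t, Real.exp (-(α * (t - T))) = Real.exp (α * T) * Real.exp (-α * t) := by
    intro t
    rw [← Real.exp_add]
    ring_nf
  have hg : MeasureTheory.IntegrableOn (fun t => a * Real.exp (-(α * (t - T)))) (Ioi T) := by
    simp only [hexp]
    exact ((exp_neg_integrableOn_Ioi T hα).const_mul _).const_mul _
  have hval : ∫ t in Ioi T, a * Real.exp (-(α * (t - T))) = a / α := by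
    simp only [hexp, MeasureTheory.integral_const_mul]
    rw [integral_exp_mul_Ioi (by linarith)]
    rw [mul_div_assoc', mul_neg, ← Real.exp_add]
    simp
    ring
  have hae : ∀ᵐ t ∂(MeasureTheory.volume.restrict (Ioi T)),
      ‖c t‖ ≤ a * Real.exp (-(α * (t - T))) :=
    (MeasureTheory.ae_restrict_mem measurableSet_Ioi).mono fun t ht => h t ht
  have hcT : MeasureTheory.IntegrableOn c (Ioi T) := by
    refine MeasureTheory.Integrable.mono' hg ?_ hae
    exact (hc.mono fun t ht => hT.le.trans (le_of_lt ht)).aestronglyMeasurable measurableSet_Ioi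
  refine ⟨?_, ?_⟩
  · rw [← Ioc_union_Ioi_eq_Ioi hT.le]
    refine MeasureTheory.IntegrableOn.union ?_ hcT
    exact ((hc.mono Icc_subset_Ici_self).integrableOn_Icc).mono_set Ioc_subset_Icc_self
  · rw [← hval]
    exact MeasureTheory.norm_integral_le_of_norm_le hg hae

/-- Comparison of two improper integrals whose integrands are close up to time `T` and
exponentially small afterwards. -/
theorem abs_integral_sub_le {c c' : ℝ → ℝ} (hc : ContinuousOn c (Ici 0))
    (hc' : ContinuousOn c' (Ici 0)) {T a α d l : ℝ} (hT : 0 < T) (hα : 0 < α) (hl : 0 < l)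
    (hd : 0 ≤ d)
    (h : ∀ t > T, |c t| ≤ a * Real.exp (-(α * (t - T))))
    (h' : ∀ t > T, |c' t| ≤ a * Real.exp (-(α * (t - T))))
    (hdiff : ∀ t ∈ Icc 0 T, |c' t - c t| ≤ d * Real.exp (l * t)) :
    |(∫ t in Ioi 0, c' t) - ∫ t in Ioi 0, c t| ≤ d * Real.exp (l * T) / l + 2 * (a / α) := by
  obtain ⟨hi, ht⟩ := integrableOn_and_tail_le hc hT hα h
  obtain ⟨hi', ht'⟩ := integrableOn_and_tail_le hc' hT hα h'
  have hsplit : ∀ {g : ℝ → ℝ}, MeasureTheory.IntegrableOn g (Ioi 0) →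
      ∫ t in Ioi 0, g t = (∫ t in (0 : ℝ)..T, g t) + ∫ t in Ioi T, g t := by
    intro g hg
    rw [intervalIntegral.integral_of_le hT.le, ← MeasureTheory.setIntegral_union
      (Ioc_disjoint_Ioi le_rfl) measurableSet_Ioi (hg.mono_set Ioc_subset_Ioi_self)
      (hg.mono_set (Ioi_subset_Ioi hT.le)), Ioc_union_Ioi_eq_Ioi hT.le]
  have hint : ∀ {g : ℝ → ℝ}, MeasureTheory.IntegrableOn g (Ioi 0) →
      IntervalIntegrable g MeasureTheory.volume 0 T := fun hg =>
    (intervalIntegrable_iff_integrableOn_Ioc_of_le hT.le).2 (hg.mono_set Ioc_subset_Ioi_self)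
  have hval : ∫ t in (0 : ℝ)..T, d * Real.exp (l * t) ≤ d * Real.exp (l * T) / l := by
    rw [intervalIntegral.integral_const_mul, intervalIntegral.integral_comp_mul_left (fun s => Real.exp s) hl.ne',
      integral_exp, smul_eq_mul, mul_zero, Real.exp_zero, mul_div_assoc]
    refine mul_le_mul_of_nonneg_left ?_ hd
    rw [inv_mul_eq_div]
    gcongr
    linarith
  have hexpi : IntervalIntegrable (fun t : ℝ => d * Real.exp (l * t)) MeasureTheory.volume 0 T := by
    apply Continuous.intervalIntegrable
    fun_prop
  have hfin : |∫ t in (0 : ℝ)..T, (c' t - c t)| ≤ d * Real.exp (l * T) / l := by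
    refine le_trans ?_ hval
    refine intervalIntegral.norm_integral_le_of_norm_le (f := fun t => c' t - c t) hT.le ?_ hexpi
    exact Eventually.of_forall fun t ht => hdiff t (Ioc_subset_Icc_self ht)
  rw [intervalIntegral.integral_sub (hint hi') (hint hi)] at hfin
  rw [hsplit hi, hsplit hi']
  rw [abs_le] at *
  constructor <;> linarith [hfin.1, hfin.2, ht.1, ht.2, ht'.1, ht'.2]

/-! ### Feedback controls and running costs -/

namespace ControlProblem

variable {n m : ℕ} {S : ControlProblem n m}

lemma norm_transpose {a b : ℕ} (M : Matrix (Fin a) (Fin b) ℝ) : ‖Mᵀ‖ = ‖M‖ := by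
  rw [← Matrix.conjTranspose_eq_transpose_of_trivial, Matrix.l2_opNorm_conjTranspose]

lemma norm_feedback_le (hr : 0 < S.r) {B : ℝ} {x : E n} (hB : ‖S.g x‖ ≤ B) {p : E n → E n} :
    ‖S.feedback p x‖ ≤ S.r⁻¹ * B * ‖p x‖ := by
  rw [feedback, norm_neg, norm_smul, norm_inv, Real.norm_of_nonneg hr.le, mul_assoc]
  gcongr
  refine (norm_toEuclideanLin_le _ _).trans ?_
  rw [norm_transpose]
  gcongr

lemma norm_feedback_sub_le (hr : 0 < S.r) {B : ℝ} {x y : E n} (hB : ‖S.g y‖ ≤ B)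
    {p p' : E n → E n} :
    ‖S.feedback p' y - S.feedback p x‖
      ≤ S.r⁻¹ * (B * ‖p' y - p x‖ + ‖S.g y - S.g x‖ * ‖p x‖) := by
  have h1 : S.feedback p' y - S.feedback p x
      = -(S.r⁻¹ • (Matrix.toEuclideanLin (S.g y)ᵀ (p' y - p x)
        + Matrix.toEuclideanLin (S.g y - S.g x)ᵀ (p x))) := by
    simp only [feedback, Matrix.transpose_sub, map_sub, LinearMap.sub_apply, smul_add, smul_sub]
    abel
  rw [h1, norm_neg, norm_smul, norm_inv, Real.norm_of_nonneg hr.le]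
  gcongr
  refine (norm_add_le _ _).trans (add_le_add ((norm_toEuclideanLin_le _ _).trans ?_)
    ((norm_toEuclideanLin_le _ _).trans ?_))
  · rw [norm_transpose]
    gcongr
  · rw [norm_transpose]

/-- For ‖x‖ ≤ 1 the quadratic control cost is also linear in ‖x‖, so both terms of the cost inherit
the decay rate of the trajectory. -/
lemma abs_runningCost_le (hr : 0 < S.r) (κ : ℝ) {x : E n} {u : E m} {c b : ℝ}
    (hq : |S.q x| ≤ c * ‖x‖) (hu : ‖u‖ ≤ b * ‖x‖) (hx : ‖x‖ ≤ 1) :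
    |S.runningCost κ x u| ≤ (|κ| * c + 1 / 2 * (S.r * b ^ 2)) * ‖x‖ := by
  have h1 : ‖u‖ ^ 2 ≤ b ^ 2 * ‖x‖ := by
    calc ‖u‖ ^ 2 ≤ (b * ‖x‖) ^ 2 := by gcongr
      _ = b ^ 2 * (‖x‖ * ‖x‖) := by ring
      _ ≤ b ^ 2 * ‖x‖ := by
        gcongr
        exact mul_le_of_le_one_left (norm_nonneg _) hx
  rw [runningCost]
  refine (abs_add_le _ _).trans ?_
  rw [abs_mul, abs_of_nonneg (by positivity : 0 ≤ 1 / 2 * (S.r * ‖u‖ ^ 2)), add_mul]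
  refine add_le_add ?_ ?_
  · rw [mul_assoc]
    gcongr
  · rw [mul_assoc, mul_assoc]
    gcongr

lemma abs_runningCost_sub_le (hr : 0 < S.r) (κ : ℝ) {x y : E n} {u v : E m} {c b b' d : ℝ}
    (hq : |S.q y - S.q x| ≤ c * d) (huv : ‖v - u‖ ≤ b * d) (hu : ‖u‖ ≤ b') (hv : ‖v‖ ≤ b') :
    |S.runningCost κ y v - S.runningCost κ x u| ≤ (|κ| * c + S.r * (b * b')) * d := by
  have h1 : |‖v‖ ^ 2 - ‖u‖ ^ 2| ≤ b * d * (2 * b') := by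
    have h2 : ‖v‖ ^ 2 - ‖u‖ ^ 2 = (‖v‖ - ‖u‖) * (‖v‖ + ‖u‖) := by ring
    rw [h2, abs_mul, abs_of_nonneg (by positivity : 0 ≤ ‖v‖ + ‖u‖)]
    refine mul_le_mul ((abs_norm_sub_norm_le _ _).trans huv) (by linarith) (by positivity)
      ((norm_nonneg _).trans huv)
  have h3 : S.runningCost κ y v - S.runningCost κ x u
      = κ * (S.q y - S.q x) + 1 / 2 * S.r * (‖v‖ ^ 2 - ‖u‖ ^ 2) := by
    simp only [runningCost]
    ring
  rw [h3]
  refine (abs_add_le _ _).trans ?_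
  rw [abs_mul, abs_mul, abs_of_nonneg (by positivity : 0 ≤ 1 / 2 * S.r)]
  calc _ ≤ |κ| * (c * d) + 1 / 2 * S.r * (b * d * (2 * b')) := by gcongr
    _ = _ := by ring

lemma continuousOn_runningCost (κ : ℝ) {s : Set ℝ} {x : ℝ → E n}
    {p : E n → E n} (hxc : ContinuousOn x s) (hxΩ : ∀ t ∈ s, x t ∈ S.Ω)
    (hq : ContinuousOn S.q S.Ω) (hg : ContinuousOn S.g S.Ω) (hp : ContinuousOn p S.Ω) :
    ContinuousOn (fun t => S.runningCost κ (x t) (S.feedback p (x t))) s := by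
  have hu : ContinuousOn (S.feedback p) S.Ω := by
    intro z hz
    have h1 : Tendsto (fun z => (S.g z)ᵀ) (𝓝[S.Ω] z) (𝓝 (S.g z)ᵀ) := by
      refine tendsto_iff_norm_sub_tendsto_zero.2 ?_
      simpa only [← Matrix.transpose_sub, norm_transpose] using
        tendsto_iff_norm_sub_tendsto_zero.1 (hg z hz)
    exact ((tendsto_toEuclideanLin h1 (hp z hz)).const_smul S.r⁻¹).neg
  have hq' := hq.comp hxc hxΩ
  have hu' := hu.comp hxc hxΩ
  exact (hq'.const_smul κ).add (((hu'.norm.pow 2).const_smul S.r).const_smul (1 / 2 : ℝ))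

/-- The drift f cancels, so an error in the costate enters the field only through R. -/
lemma norm_closedLoop_sub_closedLoop_le' {B : ℝ} {p p' : E n → E n} {x : E n} (hB : ‖S.R x‖ ≤ B) :
    ‖S.closedLoop p' x - S.closedLoop p x‖ ≤ B * ‖p' x - p x‖ := by
  have h1 : S.closedLoop p' x - S.closedLoop p x = -Matrix.toEuclideanLin (S.R x) (p' x - p x) := by
    simp only [closedLoop, map_sub]
    abel
  rw [h1, norm_neg]
  exact (norm_toEuclideanLin_le _ _).trans (by gcongr)

end ControlProblem

/-! ### Shadowing by the perturbed closed loop -/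

/-- A quadratic Lyapunov function of a linear field is one of a nearby field. -/
lemma lyapunov_of_close {n : ℕ} {U : E n →L[ℝ] E n →L[ℝ] ℝ} {b c e α : ℝ}
    (hα : 0 ≤ α) (hαb : 2 * α * b ≤ c) (he : ‖U‖ * e ≤ c / 2) {x z w : E n}
    (hUb : U x x ≤ b * ‖x‖ ^ 2) (hw : U x w ≤ -(c * ‖x‖ ^ 2)) (h : ‖z - w‖ ≤ e * ‖x‖) :
    U x z ≤ -α * U x x := by
  have h1 := (abs_le.1 (form_perturbation_le U h)).2
  nlinarith [mul_le_mul_of_nonneg_right he (sq_nonneg ‖x‖), mul_le_mul_of_nonneg_left hUb hα,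
    mul_le_mul_of_nonneg_right hαb (sq_nonneg ‖x‖)]

/-- A solution of a vector field `F` that eventually stays close to the origin is shadowed by the
solutions of a nearby vector field `F'` with a quadratic Lyapunov function near the origin. -/
theorem exists_and_forall_shadowing {n : ℕ} {F F' : E n → E n} {Ω N : Set (E n)} (hΩ : IsOpen Ω)
    {K l e C : ℝ} (hK : 0 < K) (hKl : K ≤ l) (hC : 0 ≤ C) (he : e ≤ C * K)
    (hF : ∀ z ∈ Ω, ∀ w ∈ Ω, ‖F z - F w‖ ≤ K * ‖z - w‖)
    (hFF' : ∀ z ∈ Ω, ‖F' z - F z‖ ≤ e)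
    {K' : ℝ≥0} (hF' : LipschitzOnWith K' F' Ω) {B : ℝ} (hB : ∀ z ∈ Ω, ‖F' z‖ ≤ B)
    {U : E n →L[ℝ] E n →L[ℝ] ℝ} (hU : ∀ x y, U x y = U y x) {a b D α ρ : ℝ} (ha : 0 < a)
    (hD : 0 ≤ D) (hα : 0 ≤ α) (hbD : b ≤ D ^ 2 * a)
    (hUa : ∀ x, a * ‖x‖ ^ 2 ≤ U x x) (hUb : ∀ x, U x x ≤ b * ‖x‖ ^ 2)
    (hUF' : ∀ x ∈ Ω, ‖x‖ < ρ → U x (F' x) ≤ -α * U x x)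
    {x : ℝ → E n} (hx : IsSolutionOn F Ω (Ici 0) x) (hxN : ∀ t ≥ 0, x t ∈ N) {d : ℝ}
    (hNd : Metric.cthickening d N ⊆ Ω)
    {ε ε₀ T : ℝ} (hT : 0 < T) (hxT : ‖x T‖ < ε / 2) (hCε : C * Real.exp (l * T) ≤ ε / 2)
    (hεd : ε / 2 ≤ d) (hερ : ε < ρ) (hDε : D * ε ≤ ε₀) (hε₀ : ε₀ < ρ)
    (hball : Metric.closedBall 0 ε₀ ⊆ Ω) :
    (∃ y : ℝ → E n, IsSolutionOn F' Ω (Ici 0) y ∧ y 0 = x 0) ∧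
    ∀ y : ℝ → E n, IsSolutionOn F' Ω (Ici 0) y → y 0 = x 0 →
      (∀ t ∈ Icc 0 T, ‖y t - x t‖ ≤ C * Real.exp (l * t)) ∧
      ∀ t > T, ‖y t‖ ≤ ε₀ * Real.exp (-(α * (t - T))) := by
  have hl : 0 < l := hK.trans_le hKl
  -- Both estimates are stated on [0, τ] so that they serve the global solutions and also, in the
  -- existence proof, a solution known to be in Ω only up to τ.
  have key₁ : ∀ (y : ℝ → E n) (τ : ℝ), IsSolutionOn F' Ω (Icc 0 τ) y → y 0 = x 0 →
      ∀ t ∈ Icc 0 τ, ‖y t - x t‖ ≤ C * Real.exp (l * t) := fun y τ hy h0 =>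
    norm_sub_le_of_close_fields hK hKl hC he hF hFF' (hx.mono Icc_subset_Ici_self) hy h0
  have key₂ : ∀ (y : ℝ → E n) (τ : ℝ), T ≤ τ → IsSolutionOn F' Ω (Icc 0 τ) y → y 0 = x 0 →
      ‖y τ‖ ≤ ε₀ * Real.exp (-(α * (τ - T))) := by
    intro y τ hτ hy h0
    have h1 := key₁ y τ hy h0 T ⟨hT.le, hτ⟩
    have h2 : ‖y T‖ < ε := by
      have := norm_le_norm_add_norm_sub' (y T) (x T)
      linarith
    have h3 : D * ‖y T‖ ≤ ε₀ := (mul_le_mul_of_nonneg_left h2.le hD).trans hDε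
    have h4 := norm_le_mul_exp_of_lyapunov hU ha hD hα hbD hUa hUb hUF'
      (hy.mono (Icc_subset_Icc_left hT.le)) (h2.trans hερ) (h3.trans_lt hε₀) τ ⟨hτ, le_rfl⟩
    rw [neg_mul] at h4
    exact h4.trans (by gcongr)
  refine ⟨?_, fun y hy h0 => ⟨fun t ht => key₁ y T (hy.mono Icc_subset_Ici_self) h0 t ht,
    fun t ht => key₂ y t ht.le (hy.mono Icc_subset_Ici_self) h0⟩⟩
  obtain ⟨G, K'', B', hG, hGB, hGF⟩ := exists_bounded_lipschitz_extension hF' hB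
  obtain ⟨y, h0, hy⟩ := exists_solution_Ici hG hGB (x 0)
  have hyc : ContinuousOn y (Ici 0) := fun t ht => (hy t ht).continuousWithinAt
  have hΩt : ∀ τ, ∀ t ∈ Icc 0 τ, y t ∈ Ω := by
    intro τ
    refine forall_mem_of_no_exit (hyc.mono Icc_subset_Ici_self)
      -- The confining closed set: the tube around the exact trajectory's range up to time T, the
      -- small ball afterwards.
      (N := Metric.cthickening d N ∪ Metric.closedBall 0 ε₀) hΩ
      (Metric.isClosed_cthickening.union Metric.isClosed_closedBall) (union_subset hNd hball)
      ?_ fun s hs hin => ?_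
    · rw [h0]
      exact (hx 0 (mem_Ici.2 le_rfl)).1
    · have hsol : IsSolutionOn F' Ω (Icc 0 s) y := fun t ht =>
        ⟨hin t ht, hGF (hin t ht) ▸ (hy t ht.1).mono Icc_subset_Ici_self⟩
      rcases le_total s T with h | h
      · left
        have h1 := key₁ y s hsol h0 s ⟨hs.1, le_rfl⟩
        refine Metric.mem_cthickening_of_dist_le _ (x s) _ _ (hxN s hs.1) ?_
        rw [dist_eq_norm]
        calc ‖y s - x s‖ ≤ C * Real.exp (l * s) := h1
          _ ≤ C * Real.exp (l * T) := by gcongr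
          _ ≤ d := hCε.trans hεd
      · right
        rw [mem_closedBall_zero_iff]
        refine (key₂ y s h hsol h0).trans (mul_le_of_le_one_right ?_ ?_)
        · have : 0 ≤ ε := by linarith [norm_nonneg (x T)]
          exact (mul_nonneg hD this).trans hDε
        · rw [Real.exp_le_one_iff]
          nlinarith
  exact ⟨y, fun t ht => ⟨hΩt t t ⟨ht, le_rfl⟩, hGF (hΩt t t ⟨ht, le_rfl⟩) ▸ hy t ht⟩, h0⟩

/-! ### Comparison of the two costs -/

namespace ControlProblem

variable {n m : ℕ} {S : ControlProblem n m}

/-- Comparison of the costs of two feedback trajectories that are close up to time `T` and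
exponentially small afterwards. -/
theorem finiteCost_and_abs_J_sub_le (hr : 0 < S.r) (κ : ℝ) {L cq : ℝ≥0} {B_g B_p b δ C : ℝ}
    (hqL : LipschitzOnWith cq S.q S.Ω) (hq0 : S.q 0 = 0) (h0 : (0 : E n) ∈ S.Ω)
    (hgL : LipschitzOnWith L S.g S.Ω) (hBg : ∀ z ∈ S.Ω, ‖S.g z‖ ≤ B_g)
    {p p' : E n → E n} (hpL : LipschitzOnWith L p S.Ω) (hp'c : ContinuousOn p' S.Ω)
    (hBp : ∀ z ∈ S.Ω, ‖p z‖ ≤ B_p) (hδ : 0 ≤ δ) (hδ1 : δ ≤ 1) (hpp' : ∀ z ∈ S.Ω, ‖p' z - p z‖ ≤ δ)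
    {ρ : ℝ} (hρ : ρ ≤ 1)
    (hpb : ∀ z ∈ S.Ω, ‖z‖ < ρ → ‖p z‖ ≤ b * ‖z‖) (hp'b : ∀ z ∈ S.Ω, ‖z‖ < ρ → ‖p' z‖ ≤ b * ‖z‖)
    {x y : ℝ → E n} (hxc : ContinuousOn x (Ici 0)) (hyc : ContinuousOn y (Ici 0))
    (hxΩ : ∀ t ≥ 0, x t ∈ S.Ω) (hyΩ : ∀ t ≥ 0, y t ∈ S.Ω)
    {T l α ε₀ : ℝ} (hT : 0 < T) (hl : 0 < l) (hα : 0 < α) (hε₀ : ε₀ < ρ) (hε₀0 : 0 ≤ ε₀)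
    (hδC : δ ≤ C)
    (hxy : ∀ t ∈ Icc 0 T, ‖y t - x t‖ ≤ C * Real.exp (l * t))
    (hxT : ∀ t > T, ‖x t‖ ≤ ε₀ * Real.exp (-(α * (t - T))))
    (hyT : ∀ t > T, ‖y t‖ ≤ ε₀ * Real.exp (-(α * (t - T)))) :
    S.FiniteCost κ x (fun t => S.feedback p (x t)) ∧
    S.FiniteCost κ y (fun t => S.feedback p' (y t)) ∧
    |S.J κ y (fun t => S.feedback p' (y t)) - S.J κ x (fun t => S.feedback p (x t))|
      ≤ (|κ| * cq + S.r * (S.r⁻¹ * (B_g * (1 + L) + L * B_p) * (S.r⁻¹ * B_g * (B_p + 1))))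
          * (C * Real.exp (l * T)) / l
        + 2 * ((|κ| * cq + 1 / 2 * (S.r * (S.r⁻¹ * B_g * b) ^ 2)) * ε₀ / α) := by
  have hBg0 : 0 ≤ B_g := (norm_nonneg _).trans (hBg 0 h0)
  have hBp0 : 0 ≤ B_p := (norm_nonneg _).trans (hBp 0 h0)
  have hC0 : 0 ≤ C := hδ.trans hδC
  set M₁ := |κ| * cq + S.r * (S.r⁻¹ * (B_g * (1 + L) + L * B_p) * (S.r⁻¹ * B_g * (B_p + 1)))
    with hM₁
  set M₂ := |κ| * cq + 1 / 2 * (S.r * (S.r⁻¹ * B_g * b) ^ 2) with hM₂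
  have hM₁0 : 0 ≤ M₁ := by positivity
  have hM₂0 : 0 ≤ M₂ := by positivity
  have htail : ∀ (π : E n → E n) (z : ℝ → E n),
      (∀ w ∈ S.Ω, ‖w‖ < ρ → ‖π w‖ ≤ b * ‖w‖) → (∀ t ≥ 0, z t ∈ S.Ω) →
      (∀ t > T, ‖z t‖ ≤ ε₀ * Real.exp (-(α * (t - T)))) → ∀ t > T,
      |S.runningCost κ (z t) (S.feedback π (z t))| ≤ M₂ * ε₀ * Real.exp (-(α * (t - T))) := by
    intro π z hπ hzΩ hzT t ht
    have hz := hzΩ t (hT.trans ht).le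
    have h1 : Real.exp (-(α * (t - T))) ≤ 1 := by
      rw [Real.exp_le_one_iff]
      nlinarith [show T < t from ht]
    have h2 : ‖z t‖ < ρ := (hzT t ht).trans_lt ((mul_le_of_le_one_right hε₀0 h1).trans_lt hε₀)
    have h3 : |S.q (z t)| ≤ cq * ‖z t‖ := by
      have := hqL.dist_le_mul _ hz 0 h0
      rwa [hq0, dist_zero_right, dist_zero_right] at this
    have h4 : ‖S.feedback π (z t)‖ ≤ S.r⁻¹ * B_g * b * ‖z t‖ := by
      refine (norm_feedback_le hr (hBg _ hz)).trans ?_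
      rw [mul_assoc _ b]
      gcongr
      exact hπ _ hz h2
    refine (abs_runningCost_le hr κ h3 h4 (h2.le.trans hρ)).trans ?_
    rw [← hM₂, mul_assoc M₂]
    gcongr
    exact hzT t ht
  have hdiff : ∀ t ∈ Icc 0 T, |S.runningCost κ (y t) (S.feedback p' (y t))
      - S.runningCost κ (x t) (S.feedback p (x t))| ≤ M₁ * C * Real.exp (l * t) := by
    intro t ht
    have hxt := hxΩ t ht.1
    have hyt := hyΩ t ht.1
    set d := C * Real.exp (l * t) with hd
    have hd0 : 0 ≤ d := by positivity
    -- Since δ ≤ C ≤ d, the network error is absorbed into the bound d for the trajectory distance,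
    -- and all differences below become multiples of d.
    have hδd : δ ≤ d := hδC.trans (le_mul_of_one_le_right hC0
      (Real.one_le_exp (mul_nonneg hl.le ht.1)))
    have h1 := hxy t ht
    have h2 : |S.q (y t) - S.q (x t)| ≤ cq * d := by
      refine (hqL.dist_le_mul _ hyt _ hxt).trans ?_
      rw [dist_eq_norm]
      gcongr
    have h3 : ‖p' (y t) - p (x t)‖ ≤ (1 + L) * d := by
      have e1 := hpp' _ hyt
      have e2 := hpL.dist_le_mul _ hyt _ hxt
      rw [dist_eq_norm, dist_eq_norm] at e2
      have e3 : (L : ℝ) * ‖y t - x t‖ ≤ L * d := by gcongr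
      have e4 := norm_sub_le_norm_sub_add_norm_sub (p' (y t)) (p (y t)) (p (x t))
      linarith
    have h4 : ‖S.g (y t) - S.g (x t)‖ ≤ L * d := by
      have e2 := hgL.dist_le_mul _ hyt _ hxt
      rw [dist_eq_norm, dist_eq_norm] at e2
      exact e2.trans (by gcongr)
    have h5 : ‖S.feedback p' (y t) - S.feedback p (x t)‖
        ≤ S.r⁻¹ * (B_g * (1 + L) + L * B_p) * d := by
      refine (norm_feedback_sub_le hr (hBg _ hyt)).trans ?_
      calc _ ≤ S.r⁻¹ * (B_g * ((1 + L) * d) + L * d * B_p) := by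
            gcongr
            exact hBp _ hxt
        _ = _ := by ring
    have h6 : ‖S.feedback p (x t)‖ ≤ S.r⁻¹ * B_g * (B_p + 1) := by
      refine (norm_feedback_le hr (hBg _ hxt)).trans ?_
      gcongr
      linarith [hBp _ hxt]
    have h7 : ‖S.feedback p' (y t)‖ ≤ S.r⁻¹ * B_g * (B_p + 1) := by
      refine (norm_feedback_le hr (hBg _ hyt)).trans ?_
      gcongr
      have e1 := hpp' _ hyt
      have e2 := norm_le_norm_add_norm_sub' (p' (y t)) (p (y t))
      linarith [hBp _ hyt]
    refine (abs_runningCost_sub_le hr κ h2 h5 h6 h7).trans_eq ?_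
    rw [hd, hM₁]
    ring
  have hcx := continuousOn_runningCost κ hxc hxΩ hqL.continuousOn hgL.continuousOn hpL.continuousOn
  have hcy := continuousOn_runningCost κ hyc hyΩ hqL.continuousOn hgL.continuousOn hp'c
  refine ⟨(integrableOn_and_tail_le hcx hT hα (htail p x hpb hxΩ hxT)).1,
    (integrableOn_and_tail_le hcy hT hα (htail p' y hp'b hyΩ hyT)).1, ?_⟩
  refine (abs_integral_sub_le hcx hcy hT hα hl (mul_nonneg hM₁0 hC0) (htail p x hpb hxΩ hxT)
    (htail p' y hp'b hyΩ hyT) hdiff).trans_eq ?_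
  rw [mul_assoc M₁]

end ControlProblem

end NNFeedback

end

/-! ### Choice of constants and conclusion -/

theorem corollary3p3 {n m : ℕ} (S : ControlProblem n m)
    (A Q P : Matrix (Fin n) (Fin n) ℝ) (V : E n → ℝ) (L : ℝ≥0) (κ : ℝ)
    (hΩ_open : IsOpen S.Ω) (hΩ_bdd : Bornology.IsBounded S.Ω) (hΩ_zero : (0 : E n) ∈ S.Ω)
    (hr : 0 < S.r)
    (hC1 : S.C1 A Q) (hC2 : S.C2 A Q)
    (hV : S.IsStabilizingSolution V)
    -- `P` is the Hessian of `V` at the origin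
    (hP : HasFDerivAt (gradient V) (Matrix.toEuclideanLin P).toContinuousLinearMap 0)
    -- `L` is a common Lipschitz constant of `f, g, R, p = ∇V`
    (hL : 0 < L)
    (hLf : LipschitzOnWith L S.f S.Ω) (hLg : LipschitzOnWith L S.g S.Ω)
    (hLR : LipschitzOnWith L S.R S.Ω) (hLp : LipschitzOnWith L (gradient V) S.Ω) :
    ∃ β > 0, (∃ M : ℝ, ∀ t ≥ 0,
        ‖NormedSpace.exp (t • (A - S.R 0 * P))‖ ≤ M * Real.exp (-(β * t))) ∧
    ∃ α > 0, ∃ C₀ ≥ 1, ∃ C > 0,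
    ∀ γ₀ > 0, ∀ k : ℝ, ∀ K : Set (E n), IsCompact K → K ⊆ S.Ω →
    ∃ ε₁ > 0, ε₁ ≤ γ₀ ∧ ∀ ε₀ : ℝ, 0 < ε₀ → ε₀ < ε₁ →
    ∀ (depth width : ℕ) (θ : NetParams n depth width),
      (∀ x ∈ S.Ω, ‖x‖ < γ₀ → ‖θ.eval x - Matrix.toEuclideanLin P x‖ ≤ k * ‖x‖ ^ 2) →
    ∀ x : ℝ → E n, IsSolutionOn (S.closedLoop (gradient V)) S.Ω (Ici 0) x →
      (∀ t ≥ 0, x t ∈ K) →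
    ∀ ε T δ : ℝ, 0 < ε → ε < ε₀ / (2 * C₀) → IsAdmissibleTime x ε T →
      δ < C₀⁻¹ * β * Real.exp (-(C₀ * L * T)) * ε / 2 →
      (∀ y ∈ S.Ω, ‖θ.eval y - gradient V y‖ < δ) →
    (∃ xNN : ℝ → E n, IsSolutionOn (S.closedLoop θ.eval) S.Ω (Ici 0) xNN ∧ xNN 0 = x 0) ∧
    ∀ xNN : ℝ → E n, IsSolutionOn (S.closedLoop θ.eval) S.Ω (Ici 0) xNN → xNN 0 = x 0 →
      (∀ t ∈ Icc 0 T, ‖xNN t - x t‖ ≤ C₀ * δ * Real.exp (C₀ * L * t)) ∧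
      (∀ t > T, ‖xNN t‖ ≤ ε₀ * Real.exp (-(α * (t - T)))) ∧
      S.FiniteCost κ x (fun t => S.feedback (gradient V) (x t)) ∧
      S.FiniteCost κ xNN (fun t => S.feedback θ.eval (xNN t)) ∧
      |S.J κ xNN (fun t => S.feedback θ.eval (xNN t))
        - S.J κ x (fun t => S.feedback (gradient V) (x t))| ≤ C * ε₀ := by
  obtain ⟨U, hUs, ⟨a, ha, hUa⟩, c, hc, hUT⟩ :=
    ControlProblem.exists_lyapunov_form hΩ_open hΩ_bdd hΩ_zero hC1 hC2 hV hP hLf hLR hLp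
  obtain ⟨B_R, hBR0, hBR⟩ := exists_norm_le_of_lipschitzOnWith hΩ_bdd hΩ_zero hLR
  obtain ⟨B_p, hBp0, hBp⟩ := exists_norm_le_of_lipschitzOnWith hΩ_bdd hΩ_zero hLp
  obtain ⟨B_g, hBg0, hBg⟩ := exists_norm_le_of_lipschitzOnWith hΩ_bdd hΩ_zero hLg
  obtain ⟨cq, hcq⟩ := hC1.q_lipschitz
  obtain ⟨cf, hcf⟩ := hC1.f_expansion.bound
  have hL' : (0 : ℝ) < L := hL
  -- the constants
  obtain ⟨b, hb⟩ : ∃ v : ℝ, v = ‖U‖ + 1 := ⟨_, rfl⟩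
  have hb0 : 0 < b := by rw [hb]; positivity
  have hUb : ∀ x, U x x ≤ b * ‖x‖ ^ 2 := fun x => by
    have := (le_abs_self _).trans (U.le_opNorm₂ x x)
    rw [hb]
    linarith [sq_nonneg ‖x‖]
  -- D is the distortion between the Euclidean norm and the norm of U.
  obtain ⟨D, hD⟩ : ∃ v : ℝ, v = max 1 √(b / a) := ⟨_, rfl⟩
  have hD1 : 1 ≤ D := hD ▸ le_max_left _ _
  have hD0 : 0 ≤ D := zero_le_one.trans hD1
  have hbD : b ≤ D ^ 2 * a := by
    rw [← div_le_iff₀ ha]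
    exact (Real.sqrt_le_left hD0).1 (hD ▸ le_max_right _ _)
  -- c / b is the decay rate that U gives for the linear field; the cap 1 is what turns the
  -- hypothesis on δ into C₀ δ exp(C₀LT) ≤ ε/2.
  obtain ⟨β, hβ⟩ : ∃ v : ℝ, v = min 1 (c / b) := ⟨_, rfl⟩
  have hβ0 : 0 < β := by rw [hβ]; positivity
  have hβ1 : β ≤ 1 := hβ ▸ min_le_left _ _
  have hβc : β * b ≤ c := (le_div_iff₀ hb0).1 (hβ ▸ min_le_right _ _)
  -- The summands 1 + B_R + B_p make C₀ L at least the Lipschitz constant `KF` of the closed loop,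
  -- B_R / L gives B_R δ ≤ C₀ δ `KF` as Grönwall's estimate requires, and D gives D ε ≤ ε₀.
  obtain ⟨C₀, hC₀⟩ : ∃ v : ℝ, v = 1 + B_R + B_p + B_R / L + D := ⟨_, rfl⟩
  have hBRL : 0 ≤ B_R / L := by positivity
  have hC₀1 : 1 ≤ C₀ := by linarith
  have hC₀0 : 0 < C₀ := by linarith
  have hDC : D ≤ C₀ := by linarith
  obtain ⟨l, hl⟩ : ∃ v : ℝ, v = C₀ * L := ⟨_, rfl⟩
  have hl0 : 0 < l := by rw [hl]; positivity
  obtain ⟨KF, hKF⟩ : ∃ v : ℝ, v = L + B_R * L + L * B_p := ⟨_, rfl⟩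
  have hKF0 : 0 < KF := by rw [hKF]; positivity
  have hKFl : KF ≤ l := by
    rw [hKF, hl, hC₀]
    linarith [mul_nonneg hBRL hL'.le, mul_nonneg hD0 hL'.le]
  have hBRKF : B_R ≤ C₀ * KF := by
    have h1 : B_R / L * L = B_R := by field_simp
    have h2 : (L : ℝ) ≤ KF := by rw [hKF]; linarith [mul_pos hBR0 hL', mul_pos hL' hBp0]
    calc B_R = B_R / L * L := h1.symm
      _ ≤ C₀ * KF := mul_le_mul (by linarith) h2 hL'.le hC₀0.le
  obtain ⟨M₁, hM₁⟩ : ∃ v : ℝ, v = |κ| * cq + S.r * (S.r⁻¹ * (B_g * (1 + L) + L * B_p) * (S.r⁻¹ * B_g * (B_p + 1))) := ⟨_, rfl⟩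
  obtain ⟨M₂, hM₂⟩ : ∃ v : ℝ, v = |κ| * cq + 1 / 2 * (S.r * (S.r⁻¹ * B_g * (‖P‖ + L + 1)) ^ 2) := ⟨_, rfl⟩
  have hM₁0 : 0 ≤ M₁ := by rw [hM₁]; positivity
  have hM₂0 : 0 ≤ M₂ := by rw [hM₂]; positivity
  -- Half the linear rate, because the error e ‖x‖ of the nonlinear fields is allowed to consume
  -- half of c.
  obtain ⟨α, hα⟩ : ∃ v : ℝ, v = β / 2 := ⟨_, rfl⟩
  have hα0 : 0 < α := by rw [hα]; positivity
  obtain ⟨e, he⟩ : ∃ v : ℝ, v = c / 2 / (‖U‖ + 1) := ⟨_, rfl⟩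
  have he0 : 0 < e := by rw [he]; positivity
  have hUe : ‖U‖ * e ≤ c / 2 := by
    rw [he, mul_div_assoc', div_le_iff₀ (by positivity)]
    linarith [norm_nonneg U]
  have hclose : ∀ {x z : E n}, ‖z - Matrix.toEuclideanLin (A - S.R 0 * P) x‖ ≤ e * ‖x‖ →
      U x z ≤ -α * U x x := fun {x z} h =>
    lyapunov_of_close hα0.le (by rw [hα]; linarith) hUe (hUb x) (hUT x) h
  refine ⟨β, hβ0, ⟨D, fun t ht => norm_exp_le_of_lyapunov hUs ha hD0 hβ0.le hbD hUa hUb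
    (fun x => ?_) ht⟩, α, hα0, C₀, hC₀1, M₁ / l + 2 * (M₂ / α) + 1, by positivity, ?_⟩
  · linarith [hUT x, mul_le_mul_of_nonneg_left (hUb x) hβ0.le,
      mul_le_mul_of_nonneg_right hβc (sq_nonneg ‖x‖)]
  intro γ₀ hγ₀ k K hK hKΩ
  obtain ⟨d, hd0, hKd⟩ := hK.exists_cthickening_subset_open hΩ_open hKΩ
  have hev := ControlProblem.eventually_norm_closedLoop_sub_le hΩ_open hΩ_zero hC1 hLR hBR0 hBR
    hV.gradient_zero hP he0
  have hΩev : ∀ᶠ z in 𝓝 (0 : E n), z ∈ S.Ω := hΩ_open.mem_nhds hΩ_zero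
  obtain ⟨η, hη0, hη⟩ := Metric.eventually_nhds_iff_ball.1
    (hΩev.and (hev.and hcf))
  -- Coefficient of ‖z‖² in the distance of the network field to its linearization: remainder of f,
  -- network error, variation of R.
  obtain ⟨E₀, hE₀⟩ : ∃ v : ℝ, v = |cf| + B_R * |k| + L * ‖P‖ + 1 := ⟨_, rfl⟩
  have hE₀0 : 0 < E₀ := by rw [hE₀]; positivity
  -- γ₀ makes the network bound available, 1 serves the cost estimates and δ ≤ 1, η the local
  -- expansions and the ball inside Ω, d the tube around K, 1 / (|k| + 1) the linear growth of the
  -- network, and e / E₀ its Lyapunov inequality.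
  obtain ⟨ε₁, hε₁0, hε₁γ, hε₁1, hε₁η, hε₁d, hε₁k, hε₁E⟩ : ∃ ε₁ > 0, ε₁ ≤ γ₀ ∧ ε₁ ≤ 1 ∧ ε₁ ≤ η ∧
      ε₁ ≤ d ∧ ε₁ ≤ 1 / (|k| + 1) ∧ ε₁ ≤ e / E₀ := by
    refine ⟨min γ₀ (min 1 (min η (min d (min (1 / (|k| + 1)) (e / E₀))))), by positivity, ?_⟩
    simp only [min_le_iff, le_refl, true_or, or_true, and_self]
  refine ⟨ε₁, hε₁0, hε₁γ, fun ε₀ hε₀0 hε₀1 depth width θ hθ x hx hxK ε T δ hε hεε₀ hT hδ hθδ => ?_⟩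
  obtain ⟨hT0, hxε⟩ := hT
  rw [← hl] at hδ ⊢
  have hδ0 : 0 < δ := (norm_nonneg _).trans_lt (hθδ 0 hΩ_zero)
  -- both fields have the Lyapunov function `U` on the ball of radius `ε₁`
  have hF : ∀ z ∈ S.Ω, ‖z‖ < ε₁ → U z (S.closedLoop (gradient V) z) ≤ -α * U z z := fun z _ hz =>
    hclose (hη z (mem_ball_zero_iff.2 (hz.trans_le hε₁η))).2.1
  have hF' : ∀ z ∈ S.Ω, ‖z‖ < ε₁ → U z (S.closedLoop θ.eval z) ≤ -α * U z z := by
    intro z hzΩ hz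
    refine hclose ?_
    have h1 := (hη z (mem_ball_zero_iff.2 (hz.trans_le hε₁η))).2.2
    rw [norm_pow, norm_norm] at h1
    have h2 := ControlProblem.norm_closedLoop_sub_le (A := A) (P := P) hΩ_zero hLR θ.eval hzΩ
    have h3 := hθ z hzΩ (hz.trans_le hε₁γ)
    have h4 : ‖S.R z‖ * ‖θ.eval z - Matrix.toEuclideanLin P z‖ ≤ B_R * (|k| * ‖z‖ ^ 2) := by
      refine mul_le_mul (hBR z hzΩ) (h3.trans ?_) (norm_nonneg _) hBR0.le
      gcongr
      exact le_abs_self k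
    have h5 : cf * ‖z‖ ^ 2 ≤ |cf| * ‖z‖ ^ 2 := by
      gcongr
      exact le_abs_self cf
    have h6 : E₀ * ‖z‖ ≤ e := by
      have := (le_div_iff₀ hE₀0).1 (hz.le.trans hε₁E)
      linarith
    have h7 := mul_le_mul_of_nonneg_right h6 (norm_nonneg z)
    rw [hE₀] at h7
    linarith [sq_nonneg ‖z‖]
  have hpb : ∀ z ∈ S.Ω, ‖z‖ < ε₁ → ‖gradient V z‖ ≤ (‖P‖ + L + 1) * ‖z‖ := by
    intro z hz _
    have h1 := hLp.dist_le_mul z hz 0 hΩ_zero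
    rw [hV.gradient_zero, dist_zero_right, dist_zero_right] at h1
    refine h1.trans ?_
    gcongr
    linarith [norm_nonneg P]
  have hpb' : ∀ z ∈ S.Ω, ‖z‖ < ε₁ → ‖θ.eval z‖ ≤ (‖P‖ + L + 1) * ‖z‖ := by
    intro z hzΩ hz
    have h1 := hθ z hzΩ (hz.trans_le hε₁γ)
    have h2 := norm_toEuclideanLin_le P z
    have h3 := norm_le_norm_add_norm_sub' (θ.eval z) (Matrix.toEuclideanLin P z)
    have h4 : |k| * ‖z‖ ≤ 1 := by
      have := (le_div_iff₀ (by positivity)).1 (hz.le.trans hε₁k)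
      linarith [norm_nonneg z]
    have h5 : k * ‖z‖ ^ 2 ≤ |k| * ‖z‖ * ‖z‖ := by
      rw [mul_assoc, ← sq]
      gcongr
      exact le_abs_self k
    linarith [mul_le_mul_of_nonneg_right h4 (norm_nonneg z), norm_nonneg z,
      mul_nonneg hL'.le (norm_nonneg z)]
  -- regularity of the network field
  obtain ⟨Kθ, hKθ⟩ := θ.exists_lipschitzOnWith_eval hΩ_bdd
  obtain ⟨B_θ, hBθ0, hBθ⟩ := exists_norm_le_of_lipschitzOnWith hΩ_bdd hΩ_zero hKθ
  have hlip' : LipschitzOnWith (L + B_R.toNNReal * Kθ + L * B_θ.toNNReal)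
      (S.closedLoop θ.eval) S.Ω := by
    refine LipschitzOnWith.of_dist_le_mul fun z hz w hw => ?_
    rw [dist_eq_norm, dist_eq_norm]
    have := ControlProblem.norm_closedLoop_sub_closedLoop_le hLf hLR hBR hKθ hBθ hz hw
    simpa [Real.coe_toNNReal _ hBR0.le, Real.coe_toNNReal _ hBθ0.le] using this
  obtain ⟨B_F, -, hBF⟩ := exists_norm_le_of_lipschitzOnWith hΩ_bdd hΩ_zero hlip'
  -- smallness relations
  have hεC : 2 * C₀ * ε < ε₀ := by
    rw [lt_div_iff₀ (by positivity)] at hεε₀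
    linarith
  have hεε : ε < ε₀ := by linarith [le_mul_of_one_le_left hε.le hC₀1]
  have hCδ : C₀ * δ * Real.exp (l * T) ≤ ε / 2 := by
    have h1 : C₀ * δ * Real.exp (l * T)
        ≤ C₀ * (C₀⁻¹ * β * Real.exp (-(l * T)) * ε / 2) * Real.exp (l * T) := by gcongr
    have h2 : C₀ * (C₀⁻¹ * β * Real.exp (-(l * T)) * ε / 2) * Real.exp (l * T) = β * (ε / 2) := by
      rw [Real.exp_neg]
      field_simp
    rw [h2] at h1
    exact h1.trans (mul_le_of_le_one_left (by positivity) hβ1)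
  have hδC : δ ≤ C₀ * δ := le_mul_of_one_le_left hδ0.le hC₀1
  have hδ1 : δ ≤ 1 := by
    have : C₀ * δ ≤ C₀ * δ * Real.exp (l * T) :=
      le_mul_of_one_le_right (by positivity) (Real.one_le_exp (by positivity))
    linarith
  have hDε : D * ε ≤ ε₀ := by
    linarith [mul_le_mul_of_nonneg_right hDC hε.le, mul_pos hC₀0 hε]
  have hxT := hxε T le_rfl
  have hball : Metric.closedBall 0 ε₀ ⊆ S.Ω := fun z hz =>
    (hη z (mem_ball_zero_iff.2 ((mem_closedBall_zero_iff.1 hz).trans_lt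
      (hε₀1.trans_le hε₁η)))).1
  obtain ⟨hex, hall⟩ := exists_and_forall_shadowing hΩ_open hKF0 hKFl (C := C₀ * δ) (by positivity)
    (e := B_R * δ) (by linarith [mul_le_mul_of_nonneg_right hBRKF hδ0.le])
    (fun z hz w hw => hKF ▸ ControlProblem.norm_closedLoop_sub_closedLoop_le hLf hLR hBR hLp hBp hz hw)
    (fun z hz => (ControlProblem.norm_closedLoop_sub_closedLoop_le' (hBR z hz)).trans
      (by gcongr; exact (hθδ z hz).le))
    hlip' hBF hUs ha hD0 hα0.le hbD hUa hUb hF' hx hxK hKd hT0 hxT hCδ (by linarith)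
    (by linarith) hDε hε₀1 hball
  refine ⟨hex, fun y hy hy0 => ?_⟩
  obtain ⟨h₁, h₂⟩ := hall y hy hy0
  refine ⟨h₁, h₂, ?_⟩
  have hxtail : ∀ t > T, ‖x t‖ ≤ ε₀ * Real.exp (-(α * (t - T))) := by
    intro t ht
    have h3 : D * ‖x T‖ ≤ ε₀ := by linarith [mul_le_mul_of_nonneg_left hxT.le hD0]
    have h4 := norm_le_mul_exp_of_lyapunov hUs ha hD0 hα0.le hbD hUa hUb hF
      (hx.mono fun s (hs : s ∈ Icc T t) => hT0.le.trans hs.1) (by linarith)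
      (h3.trans_lt hε₀1) t ⟨ht.le, le_rfl⟩
    rw [neg_mul] at h4
    exact h4.trans (by gcongr)
  obtain ⟨hfin, hfin', hJ⟩ := ControlProblem.finiteCost_and_abs_J_sub_le hr κ hcq hC1.q_zero hΩ_zero
    hLg hBg hLp hKθ.continuousOn hBp hδ0.le hδ1 (fun z hz => (hθδ z hz).le) hε₁1 hpb hpb'
    hx.continuousOn hy.continuousOn (fun t ht => (hx t ht).1) (fun t ht => (hy t ht).1)
    hT0 hl0 hα0 hε₀1 hε₀0.le hδC h₁ hxtail h₂
  refine ⟨hfin, hfin', hJ.trans ?_⟩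
  rw [← hM₁, ← hM₂]
  -- The exponential growth up to T is already paid for: C₀ δ exp(lT) ≤ ε/2 < ε₀.
  have h5 : M₁ * (C₀ * δ * Real.exp (l * T)) / l ≤ M₁ / l * ε₀ := by
    rw [mul_div_right_comm]
    gcongr
    linarith
  have h6 : 2 * (M₂ * ε₀ / α) = 2 * (M₂ / α) * ε₀ := by ring
  rw [h6]
  linarith
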